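/- \textbf{Setting.} Let $G=(V,E)$ be a finite undirected simple graph with edge costs $c_e\ge 0$, and let $(s_1,t_1),\dots,(s_r,t_r)$ be source-sink pairs. Two nodes $s,t$ of a graph are \emph{at least $2$-node-connected} in it if it contains two distinct simple $s$-$t$ paths that share no node other than $s,t$; otherwise they are \emph{at most $1$-node-connected}. In edge-deletion $2$-route node-multicut, a set $F\subseteq E$ is \emph{feasible} if every pair $s_i,t_i$ is at most $1$-node-connected in $(V,E\setminus F)$. Consider the linear program $$\text{(P2)}\qquad \min\ \sum_{e\in E} c_ex_e\quad\text{s.t.}\quad \sum_{e\in E(P)}x_e+\sum_{v\in V(P)}y^i_v\ \ge 1\ \ (\forall i,\ \forall P\in\mathcal P_i),\qquad \sum_v y^i_v\le 1,\quad y^i_{s_i}=y^i_{t_i}=0\ \ (\forall i),\qquad x,y\ge 0,$$ where $\mathcal P_i$ is the set of simple $s_i$-$t_i$ paths of $G$, and $E(P)$, $V(P)$ are the edges and nodes of $P$. Let $(x,\{y^i\})$ be an optimal solution of (P2), $\mathrm{OPT}_{LP}$ its value and $\beta=\mathrm{OPT}_{LP}/r$. \textbf{Regions.} Let $\ell^i(u;v)$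 be the minimum of $\sum_{e\in E(P)}x_e+\sum_{w\in V(P),\,w\ne u}y^i_w$ over all $u$-$v$ paths $P$ of $G$ ($\infty$ if there is none). For $S\subseteq V$ let $E(S)$ be the set of edges with both endpoints in $S$, and $\mathcal V(S)=\beta+\sum_{e\in E(S)}c_ex_e$. For a commodity $i$ and $\rho\ge 0$ put $B=\{v\in S:\ell^i(s_i;v)\le\rho\}$, $\Gamma=\{v\in S:\rho<\ell^i(s_i;v)\le\rho+y^i_v\}$, $\overline B=S\setminus(B\cup\Gamma)$, $\partial=\{uv\in E: u,v\in S,\ \ell^i(s_i;u)\le\rho,\ \ell^i(s_i;v)-y^i_v>\rho\}$, $$\mathcal V(\rho)=\beta+\sum_{uv\in E:\,u\in B,\,v\in B\cup\Gamma}c_{uv}x_{uv}+\sum_{uv\in\partial:\,u\in B}c_{uv}\bigl(\rho-\ell^i(s_i;u)\bigr),$$ $$\overline{\mathcal V}(\rho)=\beta+\sum_{uv\in E:\,u\in\overline B,\,v\in\overline B\cup\Gamma}c_{uv}x_{uv}+\sum_{uv\in\partial:\,u\in B}c_{uv}\bigl(\ell^i(s_i;v)-\rho-y^i_v\bigr).$$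 Call $\rho\in[0,1)$ \emph{good} for $(S,i)$ if $|\Gamma|<2$, $c(\partial)\le 4\,\mathcal V(\rho)\ln\frac{e\mathcal V(S)}{\mathcal V(\rho)}\,\ln\ln(e(r+1))$ and $c(\partial)\le 4\,\overline{\mathcal V}(\rho)\ln\frac{e\mathcal V(S)}{\overline{\mathcal V}(\rho)}\,\ln\ln(e(r+1))$, where a right-hand side whose volume factor $\mathcal V(\rho)$ or $\overline{\mathcal V}(\rho)$ is $0$ is read as $0$. \textbf{Algorithm ED-2-NMCAlg}$(U,\mathcal T)$, for $U\subseteq V$ and a set $\mathcal T$ of $N$ of the pairs, all inside $U$. Start with $S=U$, $Z=\emptyset$, $\mathcal S=\emptyset$. While some pair of $\mathcal T$ is at least $2$-node-connected in $(S,E(S))$: pick any such pair $(s_i,t_i)$ and any $\rho$ that is good for $(S,i)$; let $A=B$ if $B\cup\Gamma$ contains at most $N/2$ pairs of $\mathcal T$, and $A=\overline B$ otherwise; add $A\cup\Gamma$ to $\mathcal S$, add $\partial$ to $Z$, and replace $S$ by $S\setminus A$. After the loop, for every $A\in\mathcal S$ add to $Z$ the result of ED-2-NMCAlg$(A,\{(s_i,t_i)\in\mathcal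 T:s_i,t_i\in A\})$. Return $Z$. \textbf{Theorem.} Whatever choices are made, ED-2-NMCAlg$(V,\{(s_1,t_1),\dots,(s_r,t_r)\})$ never gets stuck (a good radius always exists when one is needed), terminates, and returns a set $Z\subseteq E$ such that every pair $s_i,t_i$ is at most $1$-node-connected in $(V,E\setminus Z)$, and $$\sum_{e\in Z}c_e\ \le\ f(r)\cdot\mathrm{OPT}_{LP},$$ where $f:\mathbb N\to\mathbb R$ is a universal function (depending on nothing but $r$) with $f(r)=O(\ln r\,\ln\ln r)$ as $r\to\infty$. -/

import Mathlib

open Filter Asymptotics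

namespace EDNMC

/-- There are at least `k` node-disjoint `s`-`t` paths in `H`: `k` distinct simple `s`-`t` paths,
no two of which share a node other than `s` and `t`. -/
def NodeConnected {V : Type*} (H : SimpleGraph V) (k : ℕ) (s t : V) : Prop :=
  ∃ P : Fin k → H.Path s t, ∀ a b : Fin k, a ≠ b →
    P a ≠ P b ∧ ∀ v ∈ (P a).1.support, v ∈ (P b).1.support → v = s ∨ v = t

/-- An instance of edge-deletion `k`-route node-multicut: an undirected graph, nonnegative edge
costs (only the values of `c` on edges of `G` matter) and `r` source-sink pairs. -/
structure Problem (V : Type*) (r : ℕ) where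
  G : SimpleGraph V
  c : Sym2 V → ℝ
  c_nonneg : ∀ e ∈ G.edgeSet, 0 ≤ c e
  s : Fin r → V
  t : Fin r → V

/-- A vector of LP variables: `x e` for the edges and `y i v` for the commodities and nodes. -/
structure LPSol (V : Type*) (r : ℕ) where
  x : Sym2 V → ℝ
  y : Fin r → V → ℝ

section

variable {V : Type*} [Fintype V] [DecidableEq V] {r : ℕ}

open Classical in
/-- `E(S)`: the edges of `G` with both endpoints in `S`. -/
noncomputable def Problem.edgesIn (I : Problem V r) (S : Finset V) : Finset (Sym2 V) :=
  {e | e ∈ I.G.edgeSet ∧ ∀ v ∈ e, v ∈ S}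

/-- The cost `c(F)` of an edge set. -/
def Problem.cost (I : Problem V r) (F : Finset (Sym2 V)) : ℝ := ∑ e ∈ F, I.c e

/-- The LP objective `∑ c_e x_e`, the sum running over all edges of the graph. -/
noncomputable def Problem.value (I : Problem V r) (p : LPSol V r) : ℝ :=
  ∑ e ∈ I.edgesIn Finset.univ, I.c e * p.x e

/-- The constraints of the LP relaxation of edge-deletion `k`-route node-multicut. -/
structure Problem.IsFeasible (I : Problem V r) (k : ℕ) (p : LPSol V r) : Prop where
  path : ∀ (i : Fin r) (P : I.G.Path (I.s i) (I.t i)),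
    1 ≤ ∑ e ∈ P.1.edges.toFinset, p.x e + ∑ v ∈ P.1.support.toFinset, p.y i v
  sum_y : ∀ i, ∑ v, p.y i v ≤ (k : ℝ) - 1
  y_source : ∀ i, p.y i (I.s i) = 0
  y_sink : ∀ i, p.y i (I.t i) = 0
  x_nonneg : ∀ e ∈ I.G.edgeSet, 0 ≤ p.x e
  y_nonneg : ∀ i v, 0 ≤ p.y i v

/-- `p` is an optimal solution of the LP relaxation. -/
def Problem.IsOptimal (I : Problem V r) (k : ℕ) (p : LPSol V r) : Prop :=
  I.IsFeasible k p ∧ ∀ p' : LPSol V r, I.IsFeasible k p' → I.value p ≤ I.value p'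

/-- The asymmetric distance `ℓ^i(u;v)`: the minimum over all `u`-`v` paths of the `x`-length of
the edges plus the `y^i`-length of the nodes other than `u` (and `⊤` if there is no path). -/
noncomputable def Problem.dist (I : Problem V r) (p : LPSol V r) (i : Fin r) (u v : V) : EReal :=
  ⨅ P : I.G.Path u v,
    ((∑ e ∈ P.1.edges.toFinset, p.x e + ∑ w ∈ P.1.support.toFinset.erase u, p.y i w : ℝ) : EReal)

open Classical in
/-- The ball `B^S_i(z,ρ)`. -/
noncomputable def Problem.ball (I : Problem V r) (p : LPSol V r) (S : Finset V) (i : Fin r)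
    (z : V) (ρ : ℝ) : Finset V :=
  {v ∈ S | I.dist p i z v ≤ (ρ : EReal)}

open Classical in
/-- The node-boundary `Γ^{S,y}_i(z,ρ)`: the nodes `v ∈ S` with `ρ < ℓ^i(z;v) ≤ ρ + y^i_v`. -/
noncomputable def Problem.nodeBdry (I : Problem V r) (p : LPSol V r) (S : Finset V) (i : Fin r)
    (z : V) (ρ : ℝ) : Finset V :=
  {v ∈ S | (ρ : EReal) < I.dist p i z v ∧ I.dist p i z v ≤ ((ρ + p.y i v : ℝ) : EReal)}

/-- The complement `S ∖ (B^S_i(z,ρ) ∪ Γ^{S,y}_i(z,ρ))`. -/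
noncomputable def Problem.coBall (I : Problem V r) (p : LPSol V r) (S : Finset V) (i : Fin r)
    (z : V) (ρ : ℝ) : Finset V :=
  S \ (I.ball p S i z ρ ∪ I.nodeBdry p S i z ρ)

open Classical in
/-- The boundary edges, oriented away from the ball: the pairs `(u,v)` of adjacent nodes of `S`
with `ℓ^i(z;u) ≤ ρ` and `ℓ^i(z;v) - y^i_v > ρ`. Every boundary edge has exactly one such
orientation. -/
noncomputable def Problem.bdryPairs (I : Problem V r) (p : LPSol V r) (S : Finset V) (i : Fin r)
    (z : V) (ρ : ℝ) : Finset (V × V) :=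
  {a | I.G.Adj a.1 a.2 ∧ a.1 ∈ S ∧ a.2 ∈ S ∧ I.dist p i z a.1 ≤ (ρ : EReal) ∧
    ((ρ + p.y i a.2 : ℝ) : EReal) < I.dist p i z a.2}

/-- The edge-boundary `∂^{S,x}_i(z,ρ)` as a set of edges. -/
noncomputable def Problem.edgeBdry (I : Problem V r) (p : LPSol V r) (S : Finset V) (i : Fin r)
    (z : V) (ρ : ℝ) : Finset (Sym2 V) :=
  (I.bdryPairs p S i z ρ).image fun a => s(a.1, a.2)

open Classical in
/-- The edges of `G` with one endpoint in `A` and the other one in `B`. -/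
noncomputable def Problem.edgesBetween (I : Problem V r) (A B : Finset V) : Finset (Sym2 V) :=
  {e | e ∈ I.G.edgeSet ∧ ∃ u ∈ A, ∃ v ∈ B, e = s(u, v)}

/-- `β = OPT / r`, where `OPT` is the value of the LP solution. -/
noncomputable def Problem.beta (I : Problem V r) (p : LPSol V r) : ℝ := I.value p / r

/-- The volume `𝒱^x(S)`. -/
noncomputable def Problem.volSet (I : Problem V r) (p : LPSol V r) (S : Finset V) : ℝ :=
  I.beta p + ∑ e ∈ I.edgesIn S, I.c e * p.x e

/-- The volume `𝒱^{S,x}_i(z,ρ)` of the ball. -/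
noncomputable def Problem.vol (I : Problem V r) (p : LPSol V r) (S : Finset V) (i : Fin r)
    (z : V) (ρ : ℝ) : ℝ :=
  I.beta p
    + ∑ e ∈ I.edgesBetween (I.ball p S i z ρ) (I.ball p S i z ρ ∪ I.nodeBdry p S i z ρ),
        I.c e * p.x e
    + ∑ a ∈ I.bdryPairs p S i z ρ, I.c s(a.1, a.2) * (ρ - (I.dist p i z a.1).toReal)

/-- The volume of the complement of the ball. -/
noncomputable def Problem.coVol (I : Problem V r) (p : LPSol V r) (S : Finset V) (i : Fin r)
    (z : V) (ρ : ℝ) : ℝ :=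
  I.beta p
    + ∑ e ∈ I.edgesBetween (I.coBall p S i z ρ) (I.coBall p S i z ρ ∪ I.nodeBdry p S i z ρ),
        I.c e * p.x e
    + ∑ a ∈ I.bdryPairs p S i z ρ,
        I.c s(a.1, a.2) * ((I.dist p i z a.2).toReal - ρ - p.y i a.2)

/-- The requirements on the radius that the region-growing step has to find: `ρ ∈ [0,1)`, the
cost of the edge-boundary is bounded in terms of both volumes, and the node-boundary has fewer
than `⌈(k-1)/α⌉` nodes. -/
structure Problem.GoodRadius (I : Problem V r) (k : ℕ) (α : ℝ) (p : LPSol V r) (S : Finset V)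
    (i : Fin r) (z : V) (ρ : ℝ) : Prop where
  nonneg : 0 ≤ ρ
  lt_one : ρ < 1
  cost_le_vol : I.cost (I.edgeBdry p S i z ρ) ≤
    2 / (1 - α) * I.vol p S i z ρ
      * Real.log (Real.exp 1 * I.volSet p S / I.vol p S i z ρ)
      * Real.log (Real.log (Real.exp 1 * ((r : ℝ) + 1)))
  cost_le_coVol : I.cost (I.edgeBdry p S i z ρ) ≤
    2 / (1 - α) * I.coVol p S i z ρ
      * Real.log (Real.exp 1 * I.volSet p S / I.coVol p S i z ρ)
      * Real.log (Real.log (Real.exp 1 * ((r : ℝ) + 1)))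
  card_lt : (I.nodeBdry p S i z ρ).card < ⌈((k : ℝ) - 1) / α⌉₊

open Classical in
/-- The pairs from `T` both of whose members lie in `A`. -/
noncomputable def Problem.pairsIn (I : Problem V r) (T : Finset (Fin r)) (A : Finset V) :
    Finset (Fin r) :=
  {i ∈ T | I.s i ∈ A ∧ I.t i ∈ A}

open Classical in
/-- `𝒯'`: the pairs from `T` that are at least 2-node-connected in `(S, E(S))`. (The graph
`fromEdgeSet E(S)` has all of `V` as its nodes, but the nodes outside `S` are isolated in it.) -/
noncomputable def Problem.active (I : Problem V r) (T : Finset (Fin r)) (S : Finset V) :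
    Finset (Fin r) :=
  {i ∈ T | NodeConnected (SimpleGraph.fromEdgeSet (I.edgesIn S : Set (Sym2 V))) 2 (I.s i) (I.t i)}

/-- The variables of one invocation of the algorithm: the current node set `S`, the current edge
set `Z` and the collection `parts` of node sets to recurse on. -/
structure LoopState (V : Type*) where
  S : Finset V
  Z : Finset (Sym2 V)
  parts : Finset (Finset V)

open Classical in
/-- The set `A` that is carved out of `S`: the ball if ball and node-boundary together contain at
most half of the pairs from `T`, and the complement otherwise. -/
noncomputable def Problem.carve (I : Problem V r) (p : LPSol V r) (T : Finset (Fin r))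
    (S : Finset V) (i : Fin r) (ρ : ℝ) : Finset V :=
  if ((I.pairsIn T (I.ball p S i (I.s i) ρ ∪ I.nodeBdry p S i (I.s i) ρ)).card : ℝ)
      ≤ (T.card : ℝ) / 2 then
    I.ball p S i (I.s i) ρ
  else
    I.coBall p S i (I.s i) ρ

/-- The state after an iteration of the while loop that uses the pair `i` and the radius `ρ`. -/
noncomputable def Problem.next (I : Problem V r) (p : LPSol V r) (T : Finset (Fin r))
    (σ : LoopState V) (i : Fin r) (ρ : ℝ) : LoopState V where
  S := σ.S \ I.carve p T σ.S i ρ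
  Z := σ.Z ∪ I.edgeBdry p σ.S i (I.s i) ρ
  parts := insert (I.carve p T σ.S i ρ ∪ I.nodeBdry p σ.S i (I.s i) ρ) σ.parts

/-- One iteration of the while loop (`k = 2`, `α = 1/2`): pick any pair that is still at least
2-node-connected in `(S, E(S))` and any radius that meets the requirements. -/
def Problem.LoopStep (I : Problem V r) (p : LPSol V r) (T : Finset (Fin r))
    (σ σ' : LoopState V) : Prop :=
  ∃ i ∈ I.active T σ.S, ∃ ρ : ℝ,
    I.GoodRadius 2 (1 / 2) p σ.S i (I.s i) ρ ∧ σ' = I.next p T σ i ρ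

/-- `σ` is a state that the while loop of the invocation on `(U, T)` can reach. -/
def Problem.LoopReaches (I : Problem V r) (p : LPSol V r) (U : Finset V) (T : Finset (Fin r))
    (σ : LoopState V) : Prop :=
  Relation.ReflTransGen (I.LoopStep p T) ⟨U, ∅, ∅⟩ σ

/-- `I.Returns p U T Z`: some execution of the algorithm on the node set `U` and the set `T` of
pairs returns the edge set `Z`. The while loop runs until no pair is active; then the algorithm
is called on every member `A` of the collection with the pairs from `T` inside `A`, and the
returned sets `W A` are added to the set `Z` of the loop. -/
inductive Problem.Returns (I : Problem V r) (p : LPSol V r) :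
    Finset V → Finset (Fin r) → Finset (Sym2 V) → Prop
  | mk (U : Finset V) (T : Finset (Fin r)) (σ : LoopState V) (W : Finset V → Finset (Sym2 V))
      (reach : I.LoopReaches p U T σ) (done : I.active T σ.S = ∅)
      (rec : ∀ A ∈ σ.parts, Problem.Returns I p A (I.pairsIn T A) (W A)) :
      Problem.Returns I p U T (σ.Z ∪ σ.parts.biUnion W)

/-- `I.Halts p U T`: every execution of the algorithm on `(U, T)` is finite and never gets stuck,
whatever choices are made. That is, the while loop has no infinite run; in every reachable state
there is a radius as required for every active pair; and all the recursive calls made after the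
loop halt as well. -/
inductive Problem.Halts (I : Problem V r) (p : LPSol V r) :
    Finset V → Finset (Fin r) → Prop
  | mk (U : Finset V) (T : Finset (Fin r))
      (finite : Acc (fun σ' σ => I.LoopStep p T σ σ') ⟨U, ∅, ∅⟩)
      (progress : ∀ σ, I.LoopReaches p U T σ → ∀ i ∈ I.active T σ.S,
        ∃ ρ, I.GoodRadius 2 (1 / 2) p σ.S i (I.s i) ρ)
      (rec : ∀ σ, I.LoopReaches p U T σ → I.active T σ.S = ∅ →
        ∀ A ∈ σ.parts, Problem.Halts I p A (I.pairsIn T A)) :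
      Problem.Halts I p U T

end

end EDNMC

/-! Put commodity `i` on a line: a node `v` occupies the interval from `pre` (distance at which it
is entered) to `rad` (distance at which it is left), of length `y i v`. The node-boundary at radius
`ρ` consists of the nodes whose interval contains `ρ`. Since the lengths sum to at most `1`, radii
with two boundary nodes have measure at most `1/2`. Off finitely many breakpoints the volume of the
ball has derivative `c(∂)`, so `-ln ln (e 𝒱(S) / 𝒱(ρ))` has derivative `c(∂) / (𝒱 ln (e 𝒱(S) / 𝒱))`.
It is monotone and grows by at most `ln ln (e (r + 1))`, because `β ≤ 𝒱(ρ) ≤ 𝒱(S) ≤ β (r + 1)`.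
Hence the cost bound fails on measure less than `1/4`, and so does the one for the complement. The
bad radii do not fill `(0,1)`: this is `exists_goodRadius`.

With at most one boundary node, the part `A ∪ Γ` and the rest `S \ A` form a separation of order at
most one once `∂` is deleted. Two node-disjoint paths cannot cross it
(`NodeConnected.of_separation`), so a pair that is still 2-node-connected survives in the part or in
the rest, and feasibility follows by induction on the recursion. Each iteration carves out an end of
the chosen pair, and each part contains at most half of the pairs, which gives termination.

The cost is charged to `potential`, `(w + n β) (ln ((β + w) / β) + size n)`. The volume `v` of the
carved side covers the part and is covered by the edges leaving `S`, up to one `β`, which the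
separated pair pays. The factor `ln (e 𝒱(S) / v)` telescopes down the recursion instead of
contributing `ln r` on each level; only its constant `1` is paid per level, and halving the pairs
bounds the number of levels (`step_le_potential`). At the root the potential is `2 OPT (ln (r + 1) +
size r)`. -/

namespace EDNMC

set_option linter.unusedSectionVars false

/-! ### Measure estimates for the sets of bad radii. -/

section Analysis

open MeasureTheory Set

/-- A monotone function on `[0,1]` that increases by at most `L` has a derivative above `4 L` only
on a set of measure less than `1/4`. -/
theorem volume_deriv_gt_lt {φ : ℝ → ℝ} {L : ℝ} (hL : 0 < L) (hφ : MonotoneOn φ (Icc 0 1))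
    (h : φ 1 - φ 0 ≤ L) :
    volume ({ρ | 4 * L < deriv φ ρ} ∩ Ioo 0 1) < ENNReal.ofReal (1 / 4) := by
  set s : Set ℝ := {ρ | 4 * L < deriv φ ρ} ∩ Ioo 0 1 with hs
  have hsm : MeasurableSet s :=
    (measurableSet_lt measurable_const (measurable_deriv φ)).inter measurableSet_Ioo
  have hu : uIcc (0 : ℝ) 1 = Icc 0 1 := uIcc_of_le zero_le_one
  have hfin : volume s ≠ ⊤ :=
    ((measure_mono inter_subset_right).trans_lt (by simp : volume (Ioo (0 : ℝ) 1) < ⊤)).ne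
  have hint : IntegrableOn (deriv φ) (Ioo 0 1) := by
    have := (hu ▸ hφ).intervalIntegrable_deriv
    rw [intervalIntegrable_iff_integrableOn_Ioo_of_le zero_le_one] at this
    exact this
  -- `φ` may jump, so the integral of its derivative can be smaller than its increment; an upper
  -- bound is all that is needed.
  have hle : ∫ ρ in Ioo 0 1, deriv φ ρ ≤ L := by
    have h1 := (hu ▸ hφ).intervalIntegral_deriv_mem_uIcc
    rw [intervalIntegral.integral_of_le zero_le_one, integral_Ioc_eq_integral_Ioo,
      uIcc_of_le (sub_nonneg.2 (hφ (by simp) (by simp) zero_le_one))] at h1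
    exact h1.2.trans h
  have hnn : ∀ ρ ∈ Ioo (0 : ℝ) 1, 0 ≤ deriv φ ρ := by
    intro ρ hρ
    rw [← derivWithin_of_mem_nhds (Icc_mem_nhds hρ.1 hρ.2)]
    exact hφ.derivWithin_nonneg
  by_contra hcon
  rw [not_lt] at hcon
  have hpos : 0 < volume s := lt_of_lt_of_le (by simp) hcon
  have hreal : (1 / 4 : ℝ) ≤ volume.real s := (ENNReal.ofReal_le_iff_le_toReal hfin).1 hcon
  have hs_int : IntegrableOn (deriv φ) s := hint.mono_set inter_subset_right
  have hc_int : IntegrableOn (fun _ : ℝ => 4 * L) s := integrableOn_const hfin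
  have h2 : ∫ ρ in s, deriv φ ρ ≤ L :=
    (setIntegral_mono_set hint ((ae_restrict_iff' measurableSet_Ioo).2 (.of_forall hnn))
      (LE.le.eventuallyLE inter_subset_right)).trans hle
  have h3 : ∫ ρ in s, (deriv φ ρ - 4 * L) = (∫ ρ in s, deriv φ ρ) - volume.real s * (4 * L) := by
    rw [integral_sub hs_int hc_int]
    simp
  -- Strictness matters: the measures `1/4`, `1/4`, `1/2` of the bad sets would otherwise add up to
  -- all of `(0,1)`.
  have h4 : 0 < ∫ ρ in s, (deriv φ ρ - 4 * L) := by
    rw [setIntegral_pos_iff_support_of_nonneg_ae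
      ((ae_restrict_iff' hsm).2 (.of_forall fun ρ hρ => (sub_pos.2 hρ.1).le))
      (hs_int.sub hc_int)]
    rwa [inter_eq_right.2]
    intro ρ hρ
    exact (sub_pos.2 hρ.1).ne'
  nlinarith

/-- If intervals `[b v, a v)` have total length at most `1`, then the points covered at least
twice have measure at most `1/2`. -/
theorem volume_two_le_card_le {V : Type*} (S : Finset V) (a b : V → ℝ)
    (hab : ∀ v ∈ S, b v ≤ a v) (hsum : ∑ v ∈ S, (a v - b v) ≤ 1) :
    volume {ρ : ℝ | 2 ≤ (S.filter fun v => ρ < a v ∧ b v ≤ ρ).card} ≤ ENNReal.ofReal (1 / 2) := by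
  classical
  let F : ℝ → ENNReal := fun ρ => ∑ v ∈ S, (Ico (b v) (a v)).indicator 1 ρ
  have hF : ∀ ρ, F ρ = ((S.filter fun v => ρ < a v ∧ b v ≤ ρ).card : ENNReal) := by
    intro ρ
    simp only [F, indicator_apply, Pi.one_apply, Finset.card_filter, Nat.cast_sum, mem_Ico]
    refine Finset.sum_congr rfl fun v _ => ?_
    by_cases h1 : ρ < a v <;> by_cases h2 : b v ≤ ρ <;> simp [h1, h2]
  have hFm : Measurable F := by
    refine Finset.measurable_sum S fun v _ => ?_
    exact measurable_one.indicator measurableSet_Ico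
  have hint : ∫⁻ ρ, F ρ ≤ 1 := by
    simp only [F]
    rw [lintegral_finsetSum _ fun v _ => measurable_one.indicator measurableSet_Ico]
    simp only [lintegral_indicator_one measurableSet_Ico, Real.volume_Ico]
    rw [← ENNReal.ofReal_sum_of_nonneg fun v hv => sub_nonneg.2 (hab v hv)]
    simpa using hsum
  -- Markov's inequality at level `2` for the number `F` of intervals covering a point.
  have hmk := (mul_meas_ge_le_lintegral hFm (μ := volume) 2).trans hint
  have hset : {ρ : ℝ | 2 ≤ (S.filter fun v => ρ < a v ∧ b v ≤ ρ).card} = {ρ | 2 ≤ F ρ} := by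
    ext ρ
    simp only [mem_ofPred_eq, hF]
    exact_mod_cast Iff.rfl
  rw [hset]
  have h2 : ENNReal.ofReal (1 / 2) = 2⁻¹ := by
    rw [one_div, ENNReal.ofReal_inv_of_pos two_pos]; simp
  rw [h2, ← one_div, ENNReal.le_div_iff_mul_le (by simp) (by simp), mul_comm]
  exact hmk

/-- Region growing: outside of a finite set, a point of `(0,1)` avoids two sets of measure less
than `1/4` and one set of measure at most `1/2`. -/
theorem exists_mem_Ioo_notMem {N A B C : Set ℝ} (hN : N.Finite)
    (hA : volume (A ∩ Ioo 0 1) < ENNReal.ofReal (1 / 4))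
    (hB : volume (B ∩ Ioo 0 1) < ENNReal.ofReal (1 / 4))
    (hC : volume C ≤ ENNReal.ofReal (1 / 2)) :
    ∃ ρ ∈ Ioo (0 : ℝ) 1, ρ ∉ N ∧ ρ ∉ A ∧ ρ ∉ B ∧ ρ ∉ C := by
  by_contra! hcon
  have hsub : Ioo (0 : ℝ) 1 ⊆ N ∪ ((A ∩ Ioo 0 1) ∪ (B ∩ Ioo 0 1) ∪ C) := by
    intro ρ hρ
    by_contra h
    simp only [mem_union, mem_inter_iff, hρ, and_true, not_or] at h
    exact h.2.2 (hcon ρ hρ h.1 h.2.1.1 h.2.1.2)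
  have h1 : (1 : ENNReal) < 1 := calc
    (1 : ENNReal) = volume (Ioo (0 : ℝ) 1) := by simp
    _ ≤ volume (N ∪ ((A ∩ Ioo 0 1) ∪ (B ∩ Ioo 0 1) ∪ C)) := measure_mono hsub
    _ ≤ volume N + (volume (A ∩ Ioo 0 1) + volume (B ∩ Ioo 0 1) + volume C) :=
      (measure_union_le _ _).trans <| add_le_add le_rfl <|
        (measure_union_le _ _).trans <| add_le_add (measure_union_le _ _) le_rfl
    _ = volume (A ∩ Ioo 0 1) + volume (B ∩ Ioo 0 1) + volume C := by
      rw [hN.measure_zero, zero_add]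
    _ < ENNReal.ofReal (1 / 4) + ENNReal.ofReal (1 / 4) + ENNReal.ofReal (1 / 2) :=
      ENNReal.add_lt_add_of_lt_of_le (hC.trans_lt ENNReal.ofReal_lt_top).ne
        (ENNReal.add_lt_add hA hB) hC
    _ = 1 := by
      rw [← ENNReal.ofReal_add (by norm_num) (by norm_num),
        ← ENNReal.ofReal_add (by norm_num) (by norm_num)]
      norm_num
  exact lt_irrefl _ h1

end Analysis

/-! ### The contribution of a single edge to the two volumes. -/

section Shares

/-- The share of the length `x` of an edge `uv` that belongs to the ball of radius `ρ`, where
`a`, `b` are the distances at which a node is completed and entered. -/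
noncomputable def ballShare (au bu av bv x ρ : ℝ) : ℝ :=
  (if (au ≤ ρ ∧ bv ≤ ρ) ∨ (av ≤ ρ ∧ bu ≤ ρ) then x else 0)
    + ((if au ≤ ρ ∧ ρ < bv then ρ - au else 0) + (if av ≤ ρ ∧ ρ < bu then ρ - av else 0))

/-- The share of the length `x` of an edge `uv` that belongs to the complement of the ball. -/
noncomputable def coShare (au bu av bv x ρ : ℝ) : ℝ :=
  (if (ρ < bu ∧ ρ < av) ∨ (ρ < bv ∧ ρ < au) then x else 0)
    + ((if au ≤ ρ ∧ ρ < bv then bv - ρ else 0) + (if av ≤ ρ ∧ ρ < bu then bu - ρ else 0))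

variable {au bu av bv x : ℝ}

/-- A cut edge contributes `ρ - au`, which grows; when `v` is entered at `ρ = bv` the share switches
to `x ≥ bv - au`, so a jump can only go up. -/
theorem ballShare_mono (hu : bu ≤ au) (hv : bv ≤ av) (huv : bv ≤ au + x) (hvu : bu ≤ av + x)
    (hx : 0 ≤ x) {ρ ρ' : ℝ} (h : ρ ≤ ρ') :
    ballShare au bu av bv x ρ ≤ ballShare au bu av bv x ρ' := by
  unfold ballShare
  grind

theorem ballShare_nonneg (hx : 0 ≤ x) (ρ : ℝ) : 0 ≤ ballShare au bu av bv x ρ := by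
  unfold ballShare
  grind

theorem ballShare_le (hu : bu ≤ au) (hv : bv ≤ av) (huv : bv ≤ au + x) (hvu : bu ≤ av + x)
    (hx : 0 ≤ x) (ρ : ℝ) : ballShare au bu av bv x ρ ≤ x := by
  unfold ballShare
  grind

theorem coShare_anti (hu : bu ≤ au) (hv : bv ≤ av) (huv : bv ≤ au + x) (hvu : bu ≤ av + x)
    (hx : 0 ≤ x) {ρ ρ' : ℝ} (h : ρ ≤ ρ') :
    coShare au bu av bv x ρ' ≤ coShare au bu av bv x ρ := by
  unfold coShare
  grind

theorem coShare_nonneg (hx : 0 ≤ x) (ρ : ℝ) : 0 ≤ coShare au bu av bv x ρ := by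
  unfold coShare
  grind

theorem coShare_le (hu : bu ≤ au) (hv : bv ≤ av) (huv : bv ≤ au + x) (hvu : bu ≤ av + x)
    (hx : 0 ≤ x) (ρ : ℝ) : coShare au bu av bv x ρ ≤ x := by
  unfold coShare
  grind

end Shares

/-! ### The asymmetric distance and its real-valued form. -/

section Distance

variable {V : Type*} [Fintype V] [DecidableEq V] {r : ℕ} {I : Problem V r} {p : LPSol V r}
  {k : ℕ}

theorem Problem.dist_nonneg (hp : I.IsFeasible k p) (i : Fin r) (u v : V) :
    0 ≤ I.dist p i u v := by
  refine le_iInf fun P => ?_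
  have h1 : 0 ≤ ∑ e ∈ P.1.edges.toFinset, p.x e :=
    Finset.sum_nonneg fun e he => hp.x_nonneg e (P.1.edges_subset_edgeSet (List.mem_toFinset.1 he))
  have h2 : 0 ≤ ∑ w ∈ P.1.support.toFinset.erase u, p.y i w :=
    Finset.sum_nonneg fun w _ => hp.y_nonneg i w
  exact_mod_cast add_nonneg h1 h2

theorem Problem.dist_self_le (i : Fin r) (u : V) : I.dist p i u u ≤ 0 := by
  refine (iInf_le _ (SimpleGraph.Path.nil : I.G.Path u u)).trans ?_
  simp

/-- Every `u`-`v` path extends to a `u`-`w` path along an edge `vw`, or already contains one. -/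
theorem Problem.dist_le_add (hp : I.IsFeasible k p) (i : Fin r) {u v w : V} (h : I.G.Adj v w) :
    I.dist p i u w ≤ I.dist p i u v + ((p.x s(v, w) + p.y i w : ℝ) : EReal) := by
  rw [← EReal.sub_le_iff_le_add (.inl (EReal.coe_ne_bot _)) (.inl (EReal.coe_ne_top _))]
  refine le_iInf fun P => ?_
  rw [EReal.sub_le_iff_le_add (.inl (EReal.coe_ne_bot _)) (.inl (EReal.coe_ne_top _)),
    ← EReal.coe_add]
  have hx : ∀ e ∈ P.1.edges.toFinset, 0 ≤ p.x e := fun e he =>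
    hp.x_nonneg e (P.1.edges_subset_edgeSet (List.mem_toFinset.1 he))
  have hvw := hp.x_nonneg s(v, w) h
  have hw := hp.y_nonneg i w
  by_cases hmem : w ∈ P.1.support
  · refine (iInf_le _ (⟨P.1.takeUntil w hmem, P.2.takeUntil hmem⟩ : I.G.Path u w)).trans ?_
    have h1 : ∑ e ∈ (P.1.takeUntil w hmem).edges.toFinset, p.x e ≤ ∑ e ∈ P.1.edges.toFinset, p.x e :=
      Finset.sum_le_sum_of_subset_of_nonneg
        (fun e he => List.mem_toFinset.2 <|
          P.1.edges_takeUntil_subset_edges hmem (List.mem_toFinset.1 he)) fun e he _ => hx e he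
    have h2 : ∑ a ∈ (P.1.takeUntil w hmem).support.toFinset.erase u, p.y i a
        ≤ ∑ a ∈ P.1.support.toFinset.erase u, p.y i a :=
      Finset.sum_le_sum_of_subset_of_nonneg
        (Finset.erase_subset_erase _ fun a ha => List.mem_toFinset.2 <|
          P.1.support_takeUntil_subset_support hmem (List.mem_toFinset.1 ha))
        fun a _ _ => hp.y_nonneg i a
    refine EReal.coe_le_coe_iff.2 ?_
    dsimp only
    linarith
  · refine (iInf_le _ (⟨P.1.concat h, P.2.concat hmem h⟩ : I.G.Path u w)).trans ?_
    have h1 : ∑ e ∈ (P.1.concat h).edges.toFinset, p.x e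
        ≤ ∑ e ∈ P.1.edges.toFinset, p.x e + p.x s(v, w) := by
      rw [SimpleGraph.Walk.edges_concat, List.concat_eq_append, List.toFinset_append]
      by_cases he : s(v, w) ∈ P.1.edges.toFinset
      · rw [Finset.union_eq_left.2 (by simpa using he)]
        linarith
      · rw [Finset.sum_union (by simpa using he)]
        simp
    have h2 : ∑ a ∈ (P.1.concat h).support.toFinset.erase u, p.y i a
        ≤ ∑ a ∈ P.1.support.toFinset.erase u, p.y i a + p.y i w := by
      have hsub : (P.1.concat h).support.toFinset.erase u
          ⊆ insert w (P.1.support.toFinset.erase u) := by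
        intro a ha
        simp only [SimpleGraph.Walk.support_concat, List.toFinset_append,
          Finset.mem_erase, Finset.mem_union, List.mem_toFinset, List.mem_singleton,
          Finset.mem_insert] at ha ⊢
        tauto
      refine (Finset.sum_le_sum_of_subset_of_nonneg hsub fun a _ _ => hp.y_nonneg i a).trans ?_
      rw [Finset.sum_insert (by simp [hmem]), add_comm]
    refine EReal.coe_le_coe_iff.2 ?_
    dsimp only
    linarith

/-- The distance `ℓ^i(z;v)` as a real number; unreachable nodes get a value above all radii. -/
noncomputable def Problem.rad (I : Problem V r) (p : LPSol V r) (i : Fin r) (z v : V) : ℝ :=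
  -- The summand `p.y i v` puts the entry distance `pre` of an unreachable node at `2`, so that it
  -- too exceeds every radius below `2`.
  open Classical in if I.dist p i z v = ⊤ then 2 + p.y i v else (I.dist p i z v).toReal

/-- The distance at which `v` is entered: `ℓ^i(z;v) - y^i_v`. -/
noncomputable def Problem.pre (I : Problem V r) (p : LPSol V r) (i : Fin r) (z v : V) : ℝ :=
  I.rad p i z v - p.y i v

theorem Problem.coe_rad (hp : I.IsFeasible k p) {i : Fin r} {z v : V} (h : I.dist p i z v ≠ ⊤) :
    (I.rad p i z v : EReal) = I.dist p i z v := by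
  rw [Problem.rad, if_neg h, EReal.coe_toReal h]
  exact ne_bot_of_le_ne_bot (by simp) (I.dist_nonneg hp i z v)

theorem Problem.pre_le_rad (hp : I.IsFeasible k p) (i : Fin r) (z v : V) :
    I.pre p i z v ≤ I.rad p i z v :=
  sub_le_self _ (hp.y_nonneg i v)

theorem Problem.rad_self (hp : I.IsFeasible k p) (i : Fin r) (z : V) : I.rad p i z z = 0 := by
  have h0 : I.dist p i z z = 0 := le_antisymm (I.dist_self_le i z) (I.dist_nonneg hp i z z)
  rw [Problem.rad, h0]
  simp

/-- This is `dist_le_add` with `y i v` moved to the left. A boundary edge thus has length at least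
the gap between leaving `u` and entering `v`. -/
theorem Problem.pre_le_rad_add (hp : I.IsFeasible k p) (i : Fin r) {z u v : V}
    (h : I.G.Adj u v) : I.pre p i z v ≤ I.rad p i z u + p.x s(u, v) := by
  have hx := hp.x_nonneg s(u, v) h
  by_cases hu : I.dist p i z u = ⊤
  · have hv : I.dist p i z v = ⊤ := by
      by_contra hv
      have := I.dist_le_add hp i (u := z) h.symm
      rw [hu, ← I.coe_rad hp hv, ← EReal.coe_add] at this
      exact EReal.coe_ne_top _ (top_le_iff.1 this)
    rw [Problem.pre, Problem.rad, Problem.rad, if_pos hu, if_pos hv]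
    linarith [hp.y_nonneg i u]
  · have h1 := I.dist_le_add hp i (u := z) h
    rw [← I.coe_rad hp hu, ← EReal.coe_add] at h1
    have hv : I.dist p i z v ≠ ⊤ := ne_top_of_le_ne_top (EReal.coe_ne_top _) h1
    rw [← I.coe_rad hp hv, EReal.coe_le_coe_iff] at h1
    rw [Problem.pre]
    linarith

theorem Problem.dist_le_coe_iff (hp : I.IsFeasible k p) {i : Fin r} {z v : V} {ρ : ℝ}
    (hρ : ρ < 2) : I.dist p i z v ≤ (ρ : EReal) ↔ I.rad p i z v ≤ ρ := by
  by_cases h : I.dist p i z v = ⊤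
  · rw [Problem.rad, if_pos h, h]
    simp only [top_le_iff, EReal.coe_ne_top, false_iff, not_le]
    linarith [hp.y_nonneg i v]
  · rw [← I.coe_rad hp h, EReal.coe_le_coe_iff]

theorem Problem.dist_le_coe_add_iff (hp : I.IsFeasible k p) {i : Fin r} {z v : V} {ρ : ℝ}
    (hρ : ρ < 2) :
    I.dist p i z v ≤ ((ρ + p.y i v : ℝ) : EReal) ↔ I.pre p i z v ≤ ρ := by
  rw [Problem.pre]
  by_cases h : I.dist p i z v = ⊤
  · rw [Problem.rad, if_pos h, h]
    simp only [top_le_iff, EReal.coe_ne_top, false_iff, not_le]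
    linarith
  · rw [← I.coe_rad hp h, EReal.coe_le_coe_iff, sub_le_iff_le_add]

/-- The sink of a commodity is entered at distance at least `1` from its source. -/
theorem Problem.one_le_pre_sink (hp : I.IsFeasible k p) (i : Fin r) :
    1 ≤ I.pre p i (I.s i) (I.t i) := by
  rw [Problem.pre, hp.y_sink, sub_zero]
  by_cases h : I.dist p i (I.s i) (I.t i) = ⊤
  · rw [Problem.rad, if_pos h, hp.y_sink]
    norm_num
  · rw [← EReal.coe_le_coe_iff, I.coe_rad hp h]
    refine le_iInf fun P => EReal.coe_le_coe_iff.2 ?_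
    have := hp.path i P
    -- `ℓ^i` omits the source while the LP constraint counts it; the two agree because `y` vanishes
    -- there.
    rwa [← Finset.sum_erase _ (hp.y_source i)] at this

/-- The source is at distance `0` from itself. Consequently no pair fits into a node-boundary of one
node. -/
theorem Problem.source_ne_sink (hp : I.IsFeasible k p) (i : Fin r) : I.s i ≠ I.t i := by
  intro h
  have h1 := I.one_le_pre_sink hp i
  have h2 := I.pre_le_rad hp i (I.s i) (I.t i)
  rw [← h, I.rad_self hp] at h2
  rw [← h] at h1
  linarith

end Distance

/-! ### Regions in terms of `rad` and `pre`, and volumes as sums of edge shares. -/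

section Regions

variable {V : Type*} [Fintype V] [DecidableEq V] {r : ℕ} {I : Problem V r} {p : LPSol V r}
  {k : ℕ} {S : Finset V} {i : Fin r} {z : V} {ρ : ℝ}

theorem Problem.mem_edgesIn {u v : V} :
    s(u, v) ∈ I.edgesIn S ↔ I.G.Adj u v ∧ u ∈ S ∧ v ∈ S := by
  simp [Problem.edgesIn]

theorem Problem.mem_ball (hp : I.IsFeasible k p) (hρ : ρ < 2) {v : V} :
    v ∈ I.ball p S i z ρ ↔ v ∈ S ∧ I.rad p i z v ≤ ρ := by
  rw [Problem.ball, Finset.mem_filter, I.dist_le_coe_iff hp hρ]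

theorem Problem.mem_nodeBdry (hp : I.IsFeasible k p) (hρ : ρ < 2) {v : V} :
    v ∈ I.nodeBdry p S i z ρ ↔ v ∈ S ∧ ρ < I.rad p i z v ∧ I.pre p i z v ≤ ρ := by
  rw [Problem.nodeBdry, Finset.mem_filter, ← not_le, I.dist_le_coe_iff hp hρ,
    I.dist_le_coe_add_iff hp hρ, not_le]

theorem Problem.mem_ball_union (hp : I.IsFeasible k p) (hρ : ρ < 2) {v : V} :
    v ∈ I.ball p S i z ρ ∪ I.nodeBdry p S i z ρ ↔ v ∈ S ∧ I.pre p i z v ≤ ρ := by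
  rw [Finset.mem_union, I.mem_ball hp hρ, I.mem_nodeBdry hp hρ]
  have := I.pre_le_rad hp i z v
  grind

theorem Problem.mem_coBall (hp : I.IsFeasible k p) (hρ : ρ < 2) {v : V} :
    v ∈ I.coBall p S i z ρ ↔ v ∈ S ∧ ρ < I.pre p i z v := by
  rw [Problem.coBall, Finset.mem_sdiff, I.mem_ball_union hp hρ]
  grind

theorem Problem.mem_coBall_union (hp : I.IsFeasible k p) (hρ : ρ < 2) {v : V} :
    v ∈ I.coBall p S i z ρ ∪ I.nodeBdry p S i z ρ ↔ v ∈ S ∧ ρ < I.rad p i z v := by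
  rw [Finset.mem_union, I.mem_coBall hp hρ, I.mem_nodeBdry hp hρ]
  have := I.pre_le_rad hp i z v
  grind

theorem Problem.mem_bdryPairs (hp : I.IsFeasible k p) (hρ : ρ < 2) {a : V × V} :
    a ∈ I.bdryPairs p S i z ρ ↔
      I.G.Adj a.1 a.2 ∧ a.1 ∈ S ∧ a.2 ∈ S ∧ I.rad p i z a.1 ≤ ρ ∧ ρ < I.pre p i z a.2 := by
  simp only [Problem.bdryPairs, Finset.mem_filter, Finset.mem_univ, true_and,
    I.dist_le_coe_iff hp hρ]
  rw [← not_le, I.dist_le_coe_add_iff hp hρ, not_le]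

theorem Problem.mem_edgesBetween {A B : Finset V} {u v : V} :
    s(u, v) ∈ I.edgesBetween A B ↔ I.G.Adj u v ∧ ((u ∈ A ∧ v ∈ B) ∨ (v ∈ A ∧ u ∈ B)) := by
  simp only [Problem.edgesBetween, Finset.mem_filter, Finset.mem_univ, true_and,
    SimpleGraph.mem_edgeSet, Sym2.eq_iff]
  grind

theorem Problem.toReal_dist_fst (hp : I.IsFeasible k p) (hρ : ρ < 2) {a : V × V}
    (ha : a ∈ I.bdryPairs p S i z ρ) : (I.dist p i z a.1).toReal = I.rad p i z a.1 := by
  have h := ((I.mem_bdryPairs hp hρ).1 ha).2.2.2.1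
  rw [← I.dist_le_coe_iff hp hρ] at h
  rw [← I.coe_rad hp (ne_top_of_le_ne_top (EReal.coe_ne_top _) h), EReal.toReal_coe]

/-- The outer end of a boundary edge is reachable through the inner one, so the default value of
`rad` does not interfere. -/
theorem Problem.toReal_dist_snd (hp : I.IsFeasible k p) (hρ : ρ < 2) {a : V × V}
    (ha : a ∈ I.bdryPairs p S i z ρ) : (I.dist p i z a.2).toReal = I.rad p i z a.2 := by
  have h := (I.mem_bdryPairs hp hρ).1 ha
  have h1 := h.2.2.2.1
  rw [← I.dist_le_coe_iff hp hρ] at h1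
  have h2 := I.dist_le_add hp i (u := z) h.1
  rw [← I.coe_rad hp (ne_top_of_le_ne_top (EReal.coe_ne_top _) h1), ← EReal.coe_add] at h2
  rw [← I.coe_rad hp (ne_top_of_le_ne_top (EReal.coe_ne_top _) h2), EReal.toReal_coe]

/-- If both orientations of an edge occurred, an endpoint would satisfy `rad ≤ ρ < pre`, against
`pre ≤ rad`. -/
theorem Problem.injOn_bdryPairs (hp : I.IsFeasible k p) (hρ : ρ < 2) :
    Set.InjOn (fun a : V × V => s(a.1, a.2)) (I.bdryPairs p S i z ρ : Set (V × V)) := by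
  rintro ⟨u, v⟩ h1 ⟨u', v'⟩ h2 h
  simp only [Finset.mem_coe, I.mem_bdryPairs hp hρ] at h1 h2
  have hv := I.pre_le_rad hp i z v
  rcases Sym2.eq_iff.1 h with ⟨h3, h4⟩ | ⟨h3, h4⟩
  · exact Prod.ext h3 h4
  · dsimp only at h3 h4
    subst h3 h4
    linarith [h1.2.2.2.2, h2.2.2.2.1]

theorem Problem.cost_edgeBdry (hp : I.IsFeasible k p) (hρ : ρ < 2) :
    I.cost (I.edgeBdry p S i z ρ) = ∑ a ∈ I.bdryPairs p S i z ρ, I.c s(a.1, a.2) := by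
  rw [Problem.cost, Problem.edgeBdry, Finset.sum_image (I.injOn_bdryPairs hp hρ)]

theorem Problem.edgeBdry_subset (hp : I.IsFeasible k p) (hρ : ρ < 2) :
    I.edgeBdry p S i z ρ ⊆ I.edgesIn S := by
  intro e he
  obtain ⟨a, ha, rfl⟩ := Finset.mem_image.1 he
  have := (I.mem_bdryPairs hp hρ).1 ha
  exact I.mem_edgesIn.2 ⟨this.1, this.2.1, this.2.2.1⟩

/-- A sum over the boundary pairs that map to the edge `uv` has one term per orientation. -/
theorem Problem.sum_bdryPairs_fiber (hp : I.IsFeasible k p) (hρ : ρ < 2) {u v : V}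
    (h : s(u, v) ∈ I.edgesIn S) (g : V × V → ℝ) :
    ∑ a ∈ I.bdryPairs p S i z ρ with s(a.1, a.2) = s(u, v), g a
      = (if I.rad p i z u ≤ ρ ∧ ρ < I.pre p i z v then g (u, v) else 0)
        + (if I.rad p i z v ≤ ρ ∧ ρ < I.pre p i z u then g (v, u) else 0) := by
  obtain ⟨hadj, hu, hv⟩ := I.mem_edgesIn.1 h
  have hne : ((u, v) : V × V) ≠ (v, u) := fun h => hadj.ne (Prod.ext_iff.1 h).1
  have hset : {a ∈ I.bdryPairs p S i z ρ | s(a.1, a.2) = s(u, v)}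
      = {a ∈ ({(u, v), (v, u)} : Finset (V × V)) | I.rad p i z a.1 ≤ ρ ∧ ρ < I.pre p i z a.2} := by
    ext ⟨a, b⟩
    simp only [Finset.mem_filter, I.mem_bdryPairs hp hρ, Sym2.eq_iff, Finset.mem_insert,
      Finset.mem_singleton, Prod.mk.injEq]
    constructor
    · rintro ⟨h1, h2⟩
      exact ⟨h2, h1.2.2.2⟩
    · rintro ⟨⟨rfl, rfl⟩ | ⟨rfl, rfl⟩, h2⟩
      · exact ⟨⟨hadj, hu, hv, h2⟩, .inl ⟨rfl, rfl⟩⟩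
      · exact ⟨⟨hadj.symm, hv, hu, h2⟩, .inr ⟨rfl, rfl⟩⟩
  rw [hset, Finset.sum_filter, Finset.sum_pair hne]

/-- Fold a sum over full edges and a sum over boundary pairs into one sum over `E(S)`. -/
theorem Problem.sum_add_sum_bdryPairs (hp : I.IsFeasible k p) (hρ : ρ < 2)
    {F : Finset (Sym2 V)} (hF : F ⊆ I.edgesIn S) (g : V × V → ℝ) :
    ∑ e ∈ F, I.c e * p.x e + ∑ a ∈ I.bdryPairs p S i z ρ, I.c s(a.1, a.2) * g a
      = ∑ e ∈ I.edgesIn S, I.c e * ((if e ∈ F then p.x e else 0)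
          + ∑ a ∈ I.bdryPairs p S i z ρ with s(a.1, a.2) = e, g a) := by
  have hmaps : ∀ a ∈ I.bdryPairs p S i z ρ, s(a.1, a.2) ∈ I.edgesIn S := fun a ha =>
    I.edgeBdry_subset hp hρ (Finset.mem_image_of_mem _ ha)
  rw [← Finset.sum_fiberwise_of_maps_to hmaps]
  simp only [mul_add, Finset.sum_add_distrib, mul_ite, mul_zero]
  congr 1
  · rw [← Finset.sum_filter, Finset.filter_mem_eq_inter, Finset.inter_eq_right.2 hF]
  · refine Finset.sum_congr rfl fun e _ => ?_
    rw [Finset.mul_sum]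
    refine Finset.sum_congr rfl fun a ha => ?_
    rw [(Finset.mem_filter.1 ha).2]

/-- The share of the edge `e` in the volume of the ball. -/
noncomputable def Problem.edgeShare (I : Problem V r) (p : LPSol V r) (S : Finset V) (i : Fin r)
    (z : V) (ρ : ℝ) (e : Sym2 V) : ℝ :=
  (if e ∈ I.edgesBetween (I.ball p S i z ρ) (I.ball p S i z ρ ∪ I.nodeBdry p S i z ρ)
    then p.x e else 0)
  + ∑ a ∈ I.bdryPairs p S i z ρ with s(a.1, a.2) = e, (ρ - I.rad p i z a.1)

/-- The share of the edge `e` in the volume of the complement of the ball. -/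
noncomputable def Problem.edgeCoShare (I : Problem V r) (p : LPSol V r) (S : Finset V) (i : Fin r)
    (z : V) (ρ : ℝ) (e : Sym2 V) : ℝ :=
  (if e ∈ I.edgesBetween (I.coBall p S i z ρ) (I.coBall p S i z ρ ∪ I.nodeBdry p S i z ρ)
    then p.x e else 0)
  + ∑ a ∈ I.bdryPairs p S i z ρ with s(a.1, a.2) = e, (I.pre p i z a.2 - ρ)

/-- Reduces statements about the volume to inequalities between five real numbers per edge. -/
theorem Problem.edgeShare_mk (hp : I.IsFeasible k p) (hρ : ρ < 2) {u v : V}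
    (h : s(u, v) ∈ I.edgesIn S) :
    I.edgeShare p S i z ρ s(u, v) = ballShare (I.rad p i z u) (I.pre p i z u) (I.rad p i z v)
      (I.pre p i z v) (p.x s(u, v)) ρ := by
  obtain ⟨hadj, hu, hv⟩ := I.mem_edgesIn.1 h
  rw [Problem.edgeShare, I.sum_bdryPairs_fiber hp hρ h, ballShare]
  simp only [I.mem_edgesBetween, I.mem_ball hp hρ, I.mem_ball_union hp hρ, hadj, hu, hv, true_and]

theorem Problem.edgeCoShare_mk (hp : I.IsFeasible k p) (hρ : ρ < 2) {u v : V}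
    (h : s(u, v) ∈ I.edgesIn S) :
    I.edgeCoShare p S i z ρ s(u, v) = coShare (I.rad p i z u) (I.pre p i z u) (I.rad p i z v)
      (I.pre p i z v) (p.x s(u, v)) ρ := by
  obtain ⟨hadj, hu, hv⟩ := I.mem_edgesIn.1 h
  rw [Problem.edgeCoShare, I.sum_bdryPairs_fiber hp hρ h, coShare]
  simp only [I.mem_edgesBetween, I.mem_coBall hp hρ, I.mem_coBall_union hp hρ, hadj, hu, hv,
    true_and]

theorem Problem.edgesBetween_subset {A B : Finset V} (hA : A ⊆ S) (hB : B ⊆ S) :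
    I.edgesBetween A B ⊆ I.edgesIn S := by
  intro e
  induction e with | _ u v
  rw [I.mem_edgesBetween, I.mem_edgesIn]
  rintro ⟨h, ⟨h1, h2⟩ | ⟨h1, h2⟩⟩
  · exact ⟨h, hA h1, hB h2⟩
  · exact ⟨h, hB h2, hA h1⟩

theorem Problem.ball_subset : I.ball p S i z ρ ⊆ S := Finset.filter_subset _ _

theorem Problem.nodeBdry_subset : I.nodeBdry p S i z ρ ⊆ S := Finset.filter_subset _ _

theorem Problem.coBall_subset : I.coBall p S i z ρ ⊆ S := Finset.sdiff_subset

theorem Problem.vol_eq (hp : I.IsFeasible k p) (hρ : ρ < 2) :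
    I.vol p S i z ρ
      = I.beta p + ∑ e ∈ I.edgesIn S, I.c e * I.edgeShare p S i z ρ e := by
  rw [Problem.vol, add_assoc]
  simp only [Problem.edgeShare]
  rw [← I.sum_add_sum_bdryPairs hp hρ (I.edgesBetween_subset I.ball_subset
    (Finset.union_subset I.ball_subset I.nodeBdry_subset)) fun a => ρ - I.rad p i z a.1]
  refine congrArg₂ _ rfl (congrArg₂ _ rfl (Finset.sum_congr rfl fun a ha => ?_))
  rw [I.toReal_dist_fst hp hρ ha]

theorem Problem.coVol_eq (hp : I.IsFeasible k p) (hρ : ρ < 2) :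
    I.coVol p S i z ρ
      = I.beta p + ∑ e ∈ I.edgesIn S, I.c e * I.edgeCoShare p S i z ρ e := by
  rw [Problem.coVol, add_assoc]
  simp only [Problem.edgeCoShare]
  rw [← I.sum_add_sum_bdryPairs hp hρ (I.edgesBetween_subset I.coBall_subset
    (Finset.union_subset I.coBall_subset I.nodeBdry_subset)) fun a => I.pre p i z a.2 - ρ]
  refine congrArg₂ _ rfl (congrArg₂ _ rfl (Finset.sum_congr rfl fun a ha => ?_))
  rw [I.toReal_dist_snd hp hρ ha, Problem.pre]
  ring

end Regions

/-! ### Existence of a good radius. -/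

section Radius

variable {V : Type*} [Fintype V] [DecidableEq V] {r : ℕ} {I : Problem V r} {p : LPSol V r}
  {k : ℕ} {S : Finset V} {i : Fin r} {z : V} {ρ : ℝ}

/-- The volume of the edges inside `S`, without the additive term `β`. -/
noncomputable def Problem.weight (I : Problem V r) (p : LPSol V r) (S : Finset V) : ℝ :=
  ∑ e ∈ I.edgesIn S, I.c e * p.x e

theorem Problem.volSet_eq : I.volSet p S = I.beta p + I.weight p S := rfl

theorem Problem.mem_edgeSet_of_mem_edgesIn {e : Sym2 V} (he : e ∈ I.edgesIn S) :
    e ∈ I.G.edgeSet := by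
  classical
  exact (Finset.mem_filter.1 he).2.1

theorem Problem.edgesIn_mono {S' : Finset V} (h : S ⊆ S') : I.edgesIn S ⊆ I.edgesIn S' := by
  intro e
  induction e with | _ u v
  rw [I.mem_edgesIn, I.mem_edgesIn]
  exact fun he => ⟨he.1, h he.2.1, h he.2.2⟩

theorem Problem.mul_nonneg_of_mem (hp : I.IsFeasible k p) {e : Sym2 V} (he : e ∈ I.edgesIn S) :
    0 ≤ I.c e * p.x e :=
  mul_nonneg (I.c_nonneg e (I.mem_edgeSet_of_mem_edgesIn he))
    (hp.x_nonneg e (I.mem_edgeSet_of_mem_edgesIn he))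

theorem Problem.weight_nonneg (hp : I.IsFeasible k p) (S : Finset V) : 0 ≤ I.weight p S :=
  Finset.sum_nonneg fun _ he => I.mul_nonneg_of_mem hp he

theorem Problem.weight_mono (hp : I.IsFeasible k p) {S' : Finset V} (h : S ⊆ S') :
    I.weight p S ≤ I.weight p S' :=
  Finset.sum_le_sum_of_subset_of_nonneg (I.edgesIn_mono h)
    fun _ he _ => I.mul_nonneg_of_mem hp he

theorem Problem.value_eq_weight : I.value p = I.weight p Finset.univ := rfl

theorem Problem.beta_nonneg (hp : I.IsFeasible k p) : 0 ≤ I.beta p :=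
  div_nonneg (I.weight_nonneg hp Finset.univ) (Nat.cast_nonneg r)

theorem Problem.edgeShare_nonneg (hp : I.IsFeasible k p) (hρ : ρ < 2) {e : Sym2 V}
    (he : e ∈ I.edgesIn S) : 0 ≤ I.edgeShare p S i z ρ e := by
  induction e with | _ u v
  rw [I.edgeShare_mk hp hρ he]
  exact ballShare_nonneg (hp.x_nonneg _ (I.mem_edgeSet_of_mem_edgesIn he)) ρ

theorem Problem.edgeCoShare_nonneg (hp : I.IsFeasible k p) (hρ : ρ < 2) {e : Sym2 V}
    (he : e ∈ I.edgesIn S) : 0 ≤ I.edgeCoShare p S i z ρ e := by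
  induction e with | _ u v
  rw [I.edgeCoShare_mk hp hρ he]
  exact coShare_nonneg (hp.x_nonneg _ (I.mem_edgeSet_of_mem_edgesIn he)) ρ

theorem Problem.pre_le_rad_add' (hp : I.IsFeasible k p) (i : Fin r) {z u v : V}
    (h : I.G.Adj u v) : I.pre p i z u ≤ I.rad p i z v + p.x s(u, v) := by
  rw [Sym2.eq_swap]
  exact I.pre_le_rad_add hp i h.symm

theorem Problem.edgeShare_le (hp : I.IsFeasible k p) (hρ : ρ < 2) {e : Sym2 V}
    (he : e ∈ I.edgesIn S) : I.edgeShare p S i z ρ e ≤ p.x e := by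
  induction e with | _ u v
  have hadj := (I.mem_edgesIn.1 he).1
  rw [I.edgeShare_mk hp hρ he]
  exact ballShare_le (I.pre_le_rad hp i z u) (I.pre_le_rad hp i z v) (I.pre_le_rad_add hp i hadj)
    (I.pre_le_rad_add' hp i hadj) (hp.x_nonneg _ hadj) ρ

theorem Problem.edgeCoShare_le (hp : I.IsFeasible k p) (hρ : ρ < 2) {e : Sym2 V}
    (he : e ∈ I.edgesIn S) : I.edgeCoShare p S i z ρ e ≤ p.x e := by
  induction e with | _ u v
  have hadj := (I.mem_edgesIn.1 he).1
  rw [I.edgeCoShare_mk hp hρ he]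
  exact coShare_le (I.pre_le_rad hp i z u) (I.pre_le_rad hp i z v) (I.pre_le_rad_add hp i hadj)
    (I.pre_le_rad_add' hp i hadj) (hp.x_nonneg _ hadj) ρ

theorem Problem.beta_le_vol (hp : I.IsFeasible k p) (hρ : ρ < 2) :
    I.beta p ≤ I.vol p S i z ρ := by
  rw [I.vol_eq hp hρ]
  exact le_add_of_nonneg_right <| Finset.sum_nonneg fun e he =>
    mul_nonneg (I.c_nonneg e (I.mem_edgeSet_of_mem_edgesIn he)) (I.edgeShare_nonneg hp hρ he)

theorem Problem.beta_le_coVol (hp : I.IsFeasible k p) (hρ : ρ < 2) :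
    I.beta p ≤ I.coVol p S i z ρ := by
  rw [I.coVol_eq hp hρ]
  exact le_add_of_nonneg_right <| Finset.sum_nonneg fun e he =>
    mul_nonneg (I.c_nonneg e (I.mem_edgeSet_of_mem_edgesIn he)) (I.edgeCoShare_nonneg hp hρ he)

theorem Problem.vol_le_volSet (hp : I.IsFeasible k p) (hρ : ρ < 2) :
    I.vol p S i z ρ ≤ I.volSet p S := by
  rw [I.vol_eq hp hρ, Problem.volSet]
  exact add_le_add le_rfl <| Finset.sum_le_sum fun e he =>
    mul_le_mul_of_nonneg_left (I.edgeShare_le hp hρ he)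
      (I.c_nonneg e (I.mem_edgeSet_of_mem_edgesIn he))

theorem Problem.coVol_le_volSet (hp : I.IsFeasible k p) (hρ : ρ < 2) :
    I.coVol p S i z ρ ≤ I.volSet p S := by
  rw [I.coVol_eq hp hρ, Problem.volSet]
  exact add_le_add le_rfl <| Finset.sum_le_sum fun e he =>
    mul_le_mul_of_nonneg_left (I.edgeCoShare_le hp hρ he)
      (I.c_nonneg e (I.mem_edgeSet_of_mem_edgesIn he))

theorem Problem.vol_mono (hp : I.IsFeasible k p) {ρ' : ℝ} (hρ' : ρ' < 2) (h : ρ ≤ ρ') :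
    I.vol p S i z ρ ≤ I.vol p S i z ρ' := by
  rw [I.vol_eq hp (h.trans_lt hρ'), I.vol_eq hp hρ']
  refine add_le_add le_rfl <| Finset.sum_le_sum fun e he =>
    mul_le_mul_of_nonneg_left ?_ (I.c_nonneg e (I.mem_edgeSet_of_mem_edgesIn he))
  induction e with | _ u v
  have hadj := (I.mem_edgesIn.1 he).1
  rw [I.edgeShare_mk hp (h.trans_lt hρ') he, I.edgeShare_mk hp hρ' he]
  exact ballShare_mono (I.pre_le_rad hp i z u) (I.pre_le_rad hp i z v)
    (I.pre_le_rad_add hp i hadj) (I.pre_le_rad_add' hp i hadj) (hp.x_nonneg _ hadj) h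

theorem Problem.coVol_anti (hp : I.IsFeasible k p) {ρ' : ℝ} (hρ' : ρ' < 2) (h : ρ ≤ ρ') :
    I.coVol p S i z ρ' ≤ I.coVol p S i z ρ := by
  rw [I.coVol_eq hp (h.trans_lt hρ'), I.coVol_eq hp hρ']
  refine add_le_add le_rfl <| Finset.sum_le_sum fun e he =>
    mul_le_mul_of_nonneg_left ?_ (I.c_nonneg e (I.mem_edgeSet_of_mem_edgesIn he))
  induction e with | _ u v
  have hadj := (I.mem_edgesIn.1 he).1
  rw [I.edgeCoShare_mk hp (h.trans_lt hρ') he, I.edgeCoShare_mk hp hρ' he]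
  exact coShare_anti (I.pre_le_rad hp i z u) (I.pre_le_rad hp i z v)
    (I.pre_le_rad_add hp i hadj) (I.pre_le_rad_add' hp i hadj) (hp.x_nonneg _ hadj) h

/-- The radii at which the regions change. -/
def Problem.breakpoints (I : Problem V r) (p : LPSol V r) (i : Fin r) (z : V) : Set ℝ :=
  Set.range (I.rad p i z) ∪ Set.range (I.pre p i z)

theorem Problem.finite_breakpoints : (I.breakpoints p i z).Finite :=
  (Set.finite_range _).union (Set.finite_range _)

theorem eventually_le_iff_of_ne {a ρ : ℝ} (h : a ≠ ρ) : ∀ᶠ ρ' in nhds ρ, (a ≤ ρ' ↔ a ≤ ρ) := by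
  rcases lt_or_gt_of_ne h with h | h
  · filter_upwards [lt_mem_nhds h] with ρ' h'
    exact ⟨fun _ => h.le, fun _ => h'.le⟩
  · filter_upwards [gt_mem_nhds h] with ρ' h'
    exact ⟨fun h1 => absurd h1 h'.not_ge, fun h1 => absurd h1 h.not_ge⟩

/-- Away from the breakpoints the regions are locally constant. -/
theorem Problem.eventually_regions_eq (hp : I.IsFeasible k p) (hρ : ρ < 2)
    (hb : ρ ∉ I.breakpoints p i z) :
    ∀ᶠ ρ' in nhds ρ, ρ' < 2 ∧ I.ball p S i z ρ' = I.ball p S i z ρ ∧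
      I.nodeBdry p S i z ρ' = I.nodeBdry p S i z ρ ∧
      I.bdryPairs p S i z ρ' = I.bdryPairs p S i z ρ := by
  have h1 : ∀ᶠ ρ' in nhds ρ, ∀ v, (I.rad p i z v ≤ ρ' ↔ I.rad p i z v ≤ ρ) :=
    eventually_all.2 fun v => eventually_le_iff_of_ne fun h => hb (.inl ⟨v, h⟩)
  have h2 : ∀ᶠ ρ' in nhds ρ, ∀ v, (I.pre p i z v ≤ ρ' ↔ I.pre p i z v ≤ ρ) :=
    eventually_all.2 fun v => eventually_le_iff_of_ne fun h => hb (.inr ⟨v, h⟩)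
  filter_upwards [h1, h2, gt_mem_nhds hρ] with ρ' h1 h2 h3
  refine ⟨h3, ?_, ?_, ?_⟩
  · ext v
    rw [I.mem_ball hp h3, I.mem_ball hp hρ, h1]
  · ext v
    rw [I.mem_nodeBdry hp h3, I.mem_nodeBdry hp hρ, h2, ← not_le, h1, not_le]
  · ext a
    rw [I.mem_bdryPairs hp h3, I.mem_bdryPairs hp hρ, h1, ← not_le, h2, not_le]

/-- Near `ρ` the regions are frozen, so the volume is affine there and each boundary edge
contributes its cost to the slope. -/
theorem Problem.hasDerivAt_vol (hp : I.IsFeasible k p) (hρ : ρ < 2)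
    (hb : ρ ∉ I.breakpoints p i z) :
    HasDerivAt (I.vol p S i z) (I.cost (I.edgeBdry p S i z ρ)) ρ := by
  have hd : HasDerivAt (fun ρ' => I.beta p
      + ∑ e ∈ I.edgesBetween (I.ball p S i z ρ) (I.ball p S i z ρ ∪ I.nodeBdry p S i z ρ),
          I.c e * p.x e
      + ∑ a ∈ I.bdryPairs p S i z ρ, I.c s(a.1, a.2) * (ρ' - (I.dist p i z a.1).toReal))
      (∑ a ∈ I.bdryPairs p S i z ρ, I.c s(a.1, a.2) * 1) ρ :=
    (HasDerivAt.fun_sum fun a _ => ((hasDerivAt_id ρ).sub_const _).const_mul _).const_add _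
  simp only [mul_one] at hd
  rw [I.cost_edgeBdry hp hρ]
  refine hd.congr_of_eventuallyEq ?_
  filter_upwards [I.eventually_regions_eq hp hρ hb (S := S)] with ρ' h
  rw [Problem.vol, h.2.1, h.2.2.1, h.2.2.2]

theorem Problem.hasDerivAt_coVol (hp : I.IsFeasible k p) (hρ : ρ < 2)
    (hb : ρ ∉ I.breakpoints p i z) :
    HasDerivAt (I.coVol p S i z) (-I.cost (I.edgeBdry p S i z ρ)) ρ := by
  have hd : HasDerivAt (fun ρ' => I.beta p
      + ∑ e ∈ I.edgesBetween (I.coBall p S i z ρ) (I.coBall p S i z ρ ∪ I.nodeBdry p S i z ρ),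
          I.c e * p.x e
      + ∑ a ∈ I.bdryPairs p S i z ρ,
          I.c s(a.1, a.2) * ((I.dist p i z a.2).toReal - ρ' - p.y i a.2))
      (∑ a ∈ I.bdryPairs p S i z ρ, I.c s(a.1, a.2) * (-1)) ρ :=
    (HasDerivAt.fun_sum fun a _ =>
      (((hasDerivAt_id ρ).const_sub _).sub_const _).const_mul _).const_add _
  simp only [mul_neg, mul_one, Finset.sum_neg_distrib] at hd
  rw [I.cost_edgeBdry hp hρ]
  refine hd.congr_of_eventuallyEq ?_
  filter_upwards [I.eventually_regions_eq hp hρ hb (S := S)] with ρ' h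
  simp only [Problem.coVol, Problem.coBall]
  rw [h.2.1, h.2.2.1, h.2.2.2]

/-- Since `β r = OPT`, the additive `β` keeps every volume ratio at most `r + 1`. -/
theorem Problem.volSet_le (hp : I.IsFeasible k p) (hr : 0 < r) (S : Finset V) :
    I.volSet p S ≤ I.beta p * ((r : ℝ) + 1) := by
  have hr' : (r : ℝ) ≠ 0 := by exact_mod_cast hr.ne'
  have h : I.beta p * r = I.value p := by rw [Problem.beta, div_mul_cancel₀ _ hr']
  have := I.weight_mono hp (Finset.subset_univ S)
  rw [I.volSet_eq, mul_add, h, I.value_eq_weight]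
  linarith

theorem Problem.log_log_pos (hr : 0 < r) :
    0 < Real.log (Real.log (Real.exp 1 * ((r : ℝ) + 1))) := by
  have hr' : (0 : ℝ) < r := by exact_mod_cast hr
  refine Real.log_pos ?_
  rw [Real.log_mul (Real.exp_ne_zero _) (by positivity), Real.log_exp]
  linarith [Real.log_pos (by linarith : (1 : ℝ) < r + 1)]

/-- The oscillation of `ln ln (e M / v)` for `v` between `b` and `M ≤ b (r + 1)`. -/
theorem log_log_bounds {b M v R : ℝ} (hb : 0 < b) (hbv : b ≤ v) (hv : v ≤ M)
    (hM : M ≤ b * R) :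
    1 ≤ Real.log (Real.exp 1 * M / v) ∧ 0 ≤ Real.log (Real.log (Real.exp 1 * M / v)) ∧
      Real.log (Real.log (Real.exp 1 * M / v)) ≤ Real.log (Real.log (Real.exp 1 * R)) := by
  have hv0 : 0 < v := hb.trans_le hbv
  have hM0 : 0 < M := hv0.trans_le hv
  have h1 : 1 ≤ Real.log (Real.exp 1 * M / v) := by
    rw [Real.le_log_iff_exp_le (by positivity), le_div_iff₀ hv0]
    exact mul_le_mul_of_nonneg_left hv (Real.exp_pos 1).le
  have h2 : Real.exp 1 * M / v ≤ Real.exp 1 * R := by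
    rw [mul_div_assoc]
    refine mul_le_mul_of_nonneg_left ?_ (Real.exp_pos 1).le
    rw [div_le_iff₀ hv0]
    have hR : 0 ≤ R := by
      by_contra h
      have := mul_neg_of_pos_of_neg hb (not_le.1 h)
      linarith
    nlinarith
  exact ⟨h1, Real.log_nonneg h1, Real.log_le_log (by linarith)
    (Real.log_le_log (by positivity) h2)⟩

theorem hasDerivAt_log_log {v : ℝ → ℝ} {M v' ρ : ℝ} (hM : 0 < M) (hv : 0 < v ρ)
    (h1 : 1 ≤ Real.log (Real.exp 1 * M / v ρ)) (h : HasDerivAt v v' ρ) :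
    HasDerivAt (fun ρ => Real.log (Real.log (Real.exp 1 * M / v ρ)))
      (-(v' / (v ρ * Real.log (Real.exp 1 * M / v ρ)))) ρ := by
  have he := Real.exp_pos 1
  have hd := ((h.fun_inv hv.ne').const_mul (Real.exp 1 * M)).log (by positivity)
  have hd2 := hd.log (by simpa only [← div_eq_mul_inv] using (by linarith :
    0 < Real.log (Real.exp 1 * M / v ρ)).ne')
  simp only [← div_eq_mul_inv] at hd2
  convert hd2 using 1
  have hl : Real.log (Real.exp 1 * M / v ρ) ≠ 0 := by linarith
  field_simp

theorem Problem.card_nodeBdry_eq (hp : I.IsFeasible k p) (hρ : ρ < 2) :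
    (I.nodeBdry p S i z ρ).card
      = (S.filter fun v => ρ < I.rad p i z v ∧ I.pre p i z v ≤ ρ).card := by
  congr 1
  ext v
  rw [I.mem_nodeBdry hp hρ, Finset.mem_filter]

/-- A boundary edge has positive length, since `rad u ≤ ρ < pre v ≤ rad u + x`; if all products `c
x` vanish, it must be free. -/
theorem Problem.cost_edgeBdry_eq_zero (hp : I.IsFeasible k p) (hρ : ρ < 2)
    (h0 : I.value p = 0) : I.cost (I.edgeBdry p S i z ρ) = 0 := by
  rw [I.cost_edgeBdry hp hρ]
  refine Finset.sum_eq_zero fun a ha => ?_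
  obtain ⟨hadj, -, -, h1, h2⟩ := (I.mem_bdryPairs hp hρ).1 ha
  have h3 := I.pre_le_rad_add hp i (z := z) hadj
  have h4 := (Finset.sum_eq_zero_iff_of_nonneg fun e he => I.mul_nonneg_of_mem hp he).1 h0
    s(a.1, a.2) (I.mem_edgesIn.2 ⟨hadj, Finset.mem_univ _, Finset.mem_univ _⟩)
  exact (mul_eq_zero.1 h4).resolve_right (by linarith)

theorem Problem.sum_rad_sub_pre_le (hp : I.IsFeasible 2 p) (S : Finset V) (i : Fin r) (z : V) :
    ∑ v ∈ S, (I.rad p i z v - I.pre p i z v) ≤ 1 := by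
  simp only [Problem.pre, sub_sub_cancel]
  refine (Finset.sum_le_sum_of_subset_of_nonneg (Finset.subset_univ S)
    fun v _ _ => hp.y_nonneg i v).trans ((hp.sum_y i).trans ?_)
  norm_num

/-- If the LP value is positive, region growing finds a radius that meets both cost bounds and
whose node-boundary has at most one node. -/
theorem Problem.exists_goodRadius_of_pos (hp : I.IsFeasible 2 p) (hr : 0 < r)
    (hβ : 0 < I.beta p) (S : Finset V) (i : Fin r) (z : V) :
    ∃ ρ, I.GoodRadius 2 (1 / 2) p S i z ρ := by
  set L := Real.log (Real.log (Real.exp 1 * ((r : ℝ) + 1))) with hLdef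
  have hL : 0 < L := Problem.log_log_pos hr
  have hM := I.volSet_le hp hr S
  have hM0 : 0 < I.volSet p S := by
    rw [I.volSet_eq]
    linarith [I.weight_nonneg hp S]
  have b1 := fun (ρ : ℝ) (hρ : ρ < 2) => log_log_bounds hβ
    (I.beta_le_vol hp hρ (S := S) (i := i) (z := z) (ρ := ρ)) (I.vol_le_volSet hp hρ) hM
  have b2 := fun (ρ : ℝ) (hρ : ρ < 2) => log_log_bounds hβ
    (I.beta_le_coVol hp hρ (S := S) (i := i) (z := z) (ρ := ρ)) (I.coVol_le_volSet hp hρ) hM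
  -- The ball grows and its complement shrinks with `ρ`; the sign makes both `φ` and `ψ` increasing.
  let φ : ℝ → ℝ := fun ρ => -Real.log (Real.log (Real.exp 1 * I.volSet p S / I.vol p S i z ρ))
  let ψ : ℝ → ℝ := fun ρ => Real.log (Real.log (Real.exp 1 * I.volSet p S / I.coVol p S i z ρ))
  have hφ : MonotoneOn φ (Set.Icc 0 1) := by
    intro ρ h ρ' h' hle
    have l1 : ρ < 2 := by linarith [h.2]
    have l2 : ρ' < 2 := by linarith [h'.2]
    have hv := hβ.trans_le (I.beta_le_vol hp l1 (S := S) (i := i) (z := z))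
    have hv' := hβ.trans_le (I.beta_le_vol hp l2 (S := S) (i := i) (z := z))
    refine neg_le_neg (Real.log_le_log (by linarith [(b1 ρ' l2).1]) (Real.log_le_log ?_ ?_))
    · positivity
    · exact div_le_div_of_nonneg_left (by positivity) hv (I.vol_mono hp l2 hle)
  have hψ : MonotoneOn ψ (Set.Icc 0 1) := by
    intro ρ h ρ' h' hle
    have l1 : ρ < 2 := by linarith [h.2]
    have l2 : ρ' < 2 := by linarith [h'.2]
    have hv := hβ.trans_le (I.beta_le_coVol hp l1 (S := S) (i := i) (z := z))
    have hv' := hβ.trans_le (I.beta_le_coVol hp l2 (S := S) (i := i) (z := z))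
    refine Real.log_le_log (by linarith [(b2 ρ l1).1]) (Real.log_le_log ?_ ?_)
    · positivity
    · exact div_le_div_of_nonneg_left (by positivity) hv' (I.coVol_anti hp l2 hle)
  have hφL : φ 1 - φ 0 ≤ L := by
    simp only [φ]
    linarith [(b1 1 (by norm_num)).2.1, (b1 0 (by norm_num)).2.2]
  have hψL : ψ 1 - ψ 0 ≤ L := by
    simp only [ψ]
    linarith [(b2 0 (by norm_num)).2.1, (b2 1 (by norm_num)).2.2]
  obtain ⟨ρ, hρ, hb, h1, h2, h3⟩ := exists_mem_Ioo_notMem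
    (I.finite_breakpoints (p := p) (i := i) (z := z)) (volume_deriv_gt_lt hL hφ hφL)
    (volume_deriv_gt_lt hL hψ hψL)
    (volume_two_le_card_le S (I.rad p i z) (I.pre p i z) (fun v _ => I.pre_le_rad hp i z v)
      (I.sum_rad_sub_pre_le hp S i z))
  have hρ2 : ρ < 2 := by linarith [hρ.2]
  have hv := hβ.trans_le (I.beta_le_vol hp hρ2 (S := S) (i := i) (z := z))
  have hw := hβ.trans_le (I.beta_le_coVol hp hρ2 (S := S) (i := i) (z := z))
  have hlv := (b1 ρ hρ2).1
  have hlw := (b2 ρ hρ2).1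
  have d1 : deriv φ ρ = _ :=
    (hasDerivAt_log_log hM0 hv hlv (I.hasDerivAt_vol hp hρ2 hb)).neg.deriv
  have d2 : deriv ψ ρ = _ :=
    (hasDerivAt_log_log hM0 hw hlw (I.hasDerivAt_coVol hp hρ2 hb)).deriv
  -- A derivative of at most `4 L`, cleared of its denominator, is the required cost bound, as `2 /
  -- (1 - 1/2) = 4`.
  simp only [Set.mem_ofPred_eq, not_lt, not_le] at h1 h2 h3
  rw [d1, neg_neg, div_le_iff₀ (by positivity)] at h1
  rw [d2, neg_div, neg_neg, div_le_iff₀ (by positivity)] at h2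
  refine ⟨ρ, hρ.1.le, hρ.2, ?_, ?_, ?_⟩
  · rw [← hLdef]
    linarith
  · rw [← hLdef]
    linarith
  · rw [I.card_nodeBdry_eq hp hρ2]
    refine lt_of_lt_of_eq h3 ?_
    norm_num

theorem Problem.exists_goodRadius (hp : I.IsFeasible 2 p) (S : Finset V) (i : Fin r) (z : V) :
    ∃ ρ, I.GoodRadius 2 (1 / 2) p S i z ρ := by
  have hr : 0 < r := i.pos
  rcases (I.beta_nonneg hp).eq_or_lt with h0 | hβ
  swap
  · exact I.exists_goodRadius_of_pos hp hr hβ S i z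
  have hr' : (r : ℝ) ≠ 0 := by exact_mod_cast hr.ne'
  have hval : I.value p = 0 := by
    rw [Problem.beta, eq_comm, div_eq_zero_iff] at h0
    exact h0.resolve_right hr'
  have hM : I.volSet p S ≤ 0 := by simpa [← h0] using I.volSet_le hp hr S
  -- If `OPT = 0`, both volumes and the boundary cost vanish, and only the node-boundary restricts
  -- the radius.
  obtain ⟨ρ, hρ, -, -, -, h3⟩ := exists_mem_Ioo_notMem Set.finite_empty
    (A := ∅) (B := ∅) (by simp) (by simp)
    (volume_two_le_card_le S (I.rad p i z) (I.pre p i z) (fun v _ => I.pre_le_rad hp i z v)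
      (I.sum_rad_sub_pre_le hp S i z))
  have hρ2 : ρ < 2 := by linarith [hρ.2]
  simp only [Set.mem_ofPred_eq, not_le] at h3
  have hv : I.vol p S i z ρ = 0 := le_antisymm ((I.vol_le_volSet hp hρ2).trans hM)
    (h0.le.trans (I.beta_le_vol hp hρ2))
  have hw : I.coVol p S i z ρ = 0 := le_antisymm ((I.coVol_le_volSet hp hρ2).trans hM)
    (h0.le.trans (I.beta_le_coVol hp hρ2))
  refine ⟨ρ, hρ.1.le, hρ.2, ?_, ?_, ?_⟩
  · simp [I.cost_edgeBdry_eq_zero hp hρ2 hval, hv]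
  · simp [I.cost_edgeBdry_eq_zero hp hρ2 hval, hw]
  · rw [I.card_nodeBdry_eq hp hρ2]
    refine lt_of_lt_of_eq h3 ?_
    norm_num

end Radius

/-! ### Node-disjoint paths and separations of order one. -/

section Separation

variable {V : Type*} {H H' : SimpleGraph V} {s t : V}

theorem NodeConnected.of_edges {k : ℕ} (P : Fin k → H.Path s t)
    (hP : ∀ a b : Fin k, a ≠ b →
      P a ≠ P b ∧ ∀ v ∈ (P a).1.support, v ∈ (P b).1.support → v = s ∨ v = t)
    (h : ∀ a, ∀ e ∈ (P a).1.edges, e ∈ H'.edgeSet) : NodeConnected H' k s t := by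
  refine ⟨fun a => ⟨(P a).1.transfer H' (h a), (P a).2.transfer (h a)⟩, fun a b hab => ⟨?_, ?_⟩⟩
  · intro he
    refine (hP a b hab).1 (Subtype.ext (SimpleGraph.Walk.ext_support ?_))
    have := congrArg (fun Q : H'.Path s t => Q.1.support) he
    simpa using this
  · intro v hva hvb
    simp only [SimpleGraph.Walk.support_transfer] at hva hvb
    exact (hP a b hab).2 v hva hvb

theorem NodeConnected.mono {k : ℕ} (hle : H ≤ H') (h : NodeConnected H k s t) :
    NodeConnected H' k s t := by
  obtain ⟨P, hP⟩ := h
  exact .of_edges P hP fun a e he =>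
    SimpleGraph.edgeSet_mono hle ((P a).1.edges_subset_edgeSet he)

/-- The trivial path is the only path from a node to itself, and the two paths must be distinct. -/
theorem NodeConnected.ne (h : NodeConnected H 2 s t) : s ≠ t := by
  rintro rfl
  obtain ⟨P, hP⟩ := h
  exact (hP 0 1 (by decide)).1 <| Subtype.ext <|
    ((SimpleGraph.Walk.isPath_iff_nil).1 (P 0).2).eq_nil.trans
      ((SimpleGraph.Walk.isPath_iff_nil).1 (P 1).2).eq_nil.symm

theorem NodeConnected.exists_adj (h : NodeConnected H 2 s t) :
    (∃ v, H.Adj s v) ∧ ∃ v, H.Adj t v := by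
  have hne := h.ne
  obtain ⟨P, -⟩ := h
  have key : ∀ {a b : V}, H.Walk a b → a ≠ b → ∃ v, H.Adj a v := by
    intro a b w hab
    cases w with
    | nil => exact absurd rfl hab
    | cons hadj _ => exact ⟨_, hadj⟩
  exact ⟨key (P 0).1 hne, key (P 0).1.reverse hne.symm⟩

variable {X Y : Finset V}

/-- A walk that leaves `X` passes through a node of `X ∩ Y`. -/
theorem exists_mem_inter_of_walk
    (hcov : ∀ u v, H.Adj u v → (u ∈ X ∧ v ∈ X) ∨ (u ∈ Y ∧ v ∈ Y)) {a b : V} (w : H.Walk a b)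
    (ha : a ∈ X) (hb : b ∉ X) : ∃ v ∈ w.support, v ∈ X ∧ v ∈ Y := by
  induction w with
  | nil => exact absurd ha hb
  | @cons a c b h w ih =>
    by_cases hc : c ∈ X
    · obtain ⟨v, hv, h1⟩ := ih hc hb
      exact ⟨v, by simp [hv], h1⟩
    · rcases hcov a c h with h1 | h1
      · exact absurd h1.2 hc
      · exact ⟨a, by simp, ha, h1.1⟩

/-- If `X ∩ Y` has at most one node, a path with both ends in `X` stays in `X`. -/
theorem support_subset_of_isPath
    (hcov : ∀ u v, H.Adj u v → (u ∈ X ∧ v ∈ X) ∨ (u ∈ Y ∧ v ∈ Y))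
    (hone : ∀ u v, u ∈ X → u ∈ Y → v ∈ X → v ∈ Y → u = v) {a b : V} {w : H.Walk a b}
    (hw : w.IsPath) (ha : a ∈ X) (hb : b ∈ X) : ∀ v ∈ w.support, v ∈ X := by
  classical
  intro v hv
  by_contra hvX
  -- An excursion to `v` outside `X` crosses `X ∩ Y` before and after `v`, so the path would visit
  -- the same node twice.
  obtain ⟨y, hy, hy1, hy2⟩ := exists_mem_inter_of_walk hcov (w.takeUntil v hv) ha hvX
  obtain ⟨y', hy', hy1', hy2'⟩ := exists_mem_inter_of_walk hcov (w.dropUntil v hv).reverse hb hvX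
  obtain rfl := hone y y' hy1 hy2 hy1' hy2'
  rw [← w.take_spec hv] at hw
  rw [SimpleGraph.Walk.support_reverse, List.mem_reverse] at hy'
  have hne : y ≠ v := fun h => hvX (h ▸ hy1)
  exact hw.ne_of_mem_support_of_append hne hy hy' rfl

/-- Two node-disjoint paths do not cross a separation of order at most one. -/
theorem NodeConnected.of_separation {HX HY : SimpleGraph V}
    (hcov : ∀ u v, H.Adj u v → (u ∈ X ∧ v ∈ X) ∨ (u ∈ Y ∧ v ∈ Y))
    (hone : ∀ u v, u ∈ X → u ∈ Y → v ∈ X → v ∈ Y → u = v)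
    (hX : ∀ u v, H.Adj u v → u ∈ X → v ∈ X → HX.Adj u v)
    (hY : ∀ u v, H.Adj u v → u ∈ Y → v ∈ Y → HY.Adj u v)
    (h : NodeConnected H 2 s t) : NodeConnected HX 2 s t ∨ NodeConnected HY 2 s t := by
  obtain ⟨⟨s', hs'⟩, ⟨t', ht'⟩⟩ := h.exists_adj
  obtain ⟨P, hP⟩ := h
  have inside : ∀ {W : Finset V} {HW : SimpleGraph V},
      (∀ u v, H.Adj u v → u ∈ W → v ∈ W → HW.Adj u v) →
      (∀ a, ∀ v ∈ (P a).1.support, v ∈ W) → NodeConnected HW 2 s t := by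
    intro W HW hW hsupp
    refine .of_edges P hP fun a e he => ?_
    induction e with | _ u v
    exact hW u v ((P a).1.adj_of_mem_edges he)
      (hsupp a u ((P a).1.fst_mem_support_of_mem_edges he))
      (hsupp a v ((P a).1.snd_mem_support_of_mem_edges he))
  have bothX : s ∈ X → t ∈ X → NodeConnected HX 2 s t := fun h1 h2 =>
    inside hX fun a => support_subset_of_isPath hcov hone (P a).2 h1 h2
  have bothY : s ∈ Y → t ∈ Y → NodeConnected HY 2 s t := fun h1 h2 =>
    inside hY fun a => support_subset_of_isPath (fun u v huv => (hcov u v huv).symm)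
      (fun u v a b c d => hone u v b a d c) (P a).2 h1 h2
  have cross : ∀ {a b : V} (w : H.Walk a b), a ∈ X → b ∈ Y →
      ∃ v ∈ w.support, v ∈ X ∧ v ∈ Y := by
    intro a b w ha hb
    by_cases hbX : b ∈ X
    · exact ⟨b, w.end_mem_support, hbX, hb⟩
    · exact exists_mem_inter_of_walk hcov w ha hbX
  have mixed : ∀ y, y ∈ X → y ∈ Y → y ∈ (P 0).1.support → y ∈ (P 1).1.support →
      y = s ∨ y = t := fun y _ _ h0 h1 => (hP 0 1 (by decide)).2 y h0 h1
  -- Only edges are assumed to be covered by `X` and `Y`, so an incident edge is needed to locate an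
  -- end.
  have hs : s ∈ X ∨ s ∈ Y := (hcov s s' hs').imp And.left And.left
  have ht : t ∈ X ∨ t ∈ Y := (hcov t t' ht').imp And.left And.left
  rcases hs with hs | hs <;> rcases ht with ht | ht
  · exact .inl (bothX hs ht)
  -- Both paths pass through the single common node. Disjointness makes it an end of the paths, and
  -- then both ends lie on one side.
  · obtain ⟨y, hy, y1, y2⟩ := cross (P 0).1 hs ht
    obtain ⟨y', hy', y1', y2'⟩ := cross (P 1).1 hs ht
    obtain rfl := hone y y' y1 y2 y1' y2'
    rcases mixed y y1 y2 hy hy' with rfl | rfl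
    · exact .inr (bothY y2 ht)
    · exact .inl (bothX hs y1)
  · obtain ⟨y, hy, y1, y2⟩ := cross (P 0).1.reverse ht hs
    obtain ⟨y', hy', y1', y2'⟩ := cross (P 1).1.reverse ht hs
    obtain rfl := hone y y' y1 y2 y1' y2'
    rw [SimpleGraph.Walk.support_reverse, List.mem_reverse] at hy hy'
    rcases mixed y y1 y2 hy hy' with rfl | rfl
    · exact .inl (bothX y1 ht)
    · exact .inr (bothY hs y2)
  · exact .inr (bothY hs ht)

end Separation

/-! ### Termination and feasibility of the algorithm. -/

section Loop

variable {V : Type*} [Fintype V] [DecidableEq V] {r : ℕ} {I : Problem V r} {p : LPSol V r}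
  {k : ℕ} {S U : Finset V} {T : Finset (Fin r)} {i : Fin r} {z : V} {ρ : ℝ} {σ σ' : LoopState V}

theorem Problem.mem_active :
    i ∈ I.active T S ↔ i ∈ T ∧
      NodeConnected (SimpleGraph.fromEdgeSet (I.edgesIn S : Set (Sym2 V))) 2 (I.s i) (I.t i) := by
  simp only [Problem.active, Finset.mem_filter]

theorem Problem.mem_pairsIn : i ∈ I.pairsIn T S ↔ i ∈ T ∧ I.s i ∈ S ∧ I.t i ∈ S := by
  rw [Problem.pairsIn, Finset.mem_filter]

theorem Problem.pairsIn_subset : I.pairsIn T S ⊆ T := fun _ hi => (I.mem_pairsIn.1 hi).1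

/-- A pair that is 2-node-connected by edges inside `S` has both of its nodes in `S`. -/
theorem Problem.mem_of_nodeConnected {F : Set (Sym2 V)} (hF : F ⊆ I.edgesIn S)
    (h : NodeConnected (SimpleGraph.fromEdgeSet F) 2 (I.s i) (I.t i)) :
    I.s i ∈ S ∧ I.t i ∈ S := by
  obtain ⟨⟨u, hu⟩, ⟨v, hv⟩⟩ := h.exists_adj
  rw [SimpleGraph.fromEdgeSet_adj] at hu hv
  exact ⟨(I.mem_edgesIn.1 (hF hu.1)).2.1, (I.mem_edgesIn.1 (hF hv.1)).2.1⟩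

theorem Problem.active_subset_pairsIn : I.active T S ⊆ I.pairsIn T S := by
  intro i hi
  rw [I.mem_active] at hi
  exact I.mem_pairsIn.2 ⟨hi.1, I.mem_of_nodeConnected subset_rfl hi.2⟩

theorem Problem.GoodRadius.lt_two (h : I.GoodRadius 2 (1 / 2) p S i z ρ) : ρ < 2 := by
  linarith [h.lt_one]

theorem Problem.GoodRadius.card_le_one (h : I.GoodRadius 2 (1 / 2) p S i z ρ) :
    (I.nodeBdry p S i z ρ).card ≤ 1 := by
  have := h.card_lt
  norm_num at this
  omega

theorem Problem.carve_eq_or : I.carve p T S i ρ = I.ball p S i (I.s i) ρ ∨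
    I.carve p T S i ρ = I.coBall p S i (I.s i) ρ := by
  unfold Problem.carve
  split_ifs <;> simp

theorem Problem.carve_subset : I.carve p T S i ρ ⊆ S := by
  rcases I.carve_eq_or (p := p) (T := T) (S := S) (i := i) (ρ := ρ) with h | h <;> rw [h]
  · exact I.ball_subset
  · exact I.coBall_subset

/-- The part carved out together with the node-boundary. -/
noncomputable def Problem.part (I : Problem V r) (p : LPSol V r) (T : Finset (Fin r))
    (S : Finset V) (i : Fin r) (ρ : ℝ) : Finset V :=
  I.carve p T S i ρ ∪ I.nodeBdry p S i (I.s i) ρ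

theorem Problem.part_subset : I.part p T S i ρ ⊆ S :=
  Finset.union_subset I.carve_subset I.nodeBdry_subset

/-- The part and what remains of `S` meet only in the node-boundary. -/
theorem Problem.mem_nodeBdry_of_mem {v : V} (h1 : v ∈ I.part p T S i ρ)
    (h2 : v ∈ S \ I.carve p T S i ρ) : v ∈ I.nodeBdry p S i (I.s i) ρ :=
  (Finset.mem_union.1 h1).resolve_left (Finset.mem_sdiff.1 h2).2

theorem Problem.GoodRadius.eq_of_mem (h : I.GoodRadius 2 (1 / 2) p S i z ρ) {u v : V}
    (hu : u ∈ I.nodeBdry p S i z ρ) (hv : v ∈ I.nodeBdry p S i z ρ) : u = v :=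
  Finset.card_le_one.1 h.card_le_one u hu v hv

/-- Every edge of `S` off the edge-boundary lies inside the part or inside the rest. -/
theorem Problem.part_or_rest (hp : I.IsFeasible k p) (hρ : ρ < 2) {u v : V}
    (he : s(u, v) ∈ I.edgesIn S) (hb : s(u, v) ∉ I.edgeBdry p S i (I.s i) ρ) :
    (u ∈ I.part p T S i ρ ∧ v ∈ I.part p T S i ρ) ∨
      (u ∈ S \ I.carve p T S i ρ ∧ v ∈ S \ I.carve p T S i ρ) := by
  obtain ⟨hadj, hu, hv⟩ := I.mem_edgesIn.1 he
  have hb1 : ¬ (I.rad p i (I.s i) u ≤ ρ ∧ ρ < I.pre p i (I.s i) v) := fun h => hb <|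
    Finset.mem_image.2 ⟨(u, v), (I.mem_bdryPairs hp hρ).2 ⟨hadj, hu, hv, h⟩, rfl⟩
  have hb2 : ¬ (I.rad p i (I.s i) v ≤ ρ ∧ ρ < I.pre p i (I.s i) u) := fun h => hb <|
    Finset.mem_image.2 ⟨(v, u), (I.mem_bdryPairs hp hρ).2 ⟨hadj.symm, hv, hu, h⟩, Sym2.eq_swap⟩
  have h1 := I.pre_le_rad hp i (I.s i) u
  have h2 := I.pre_le_rad hp i (I.s i) v
  unfold Problem.part
  rcases I.carve_eq_or (p := p) (T := T) (S := S) (i := i) (ρ := ρ) with h | h <;> rw [h]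
  · simp only [I.mem_ball_union hp hρ, Finset.mem_sdiff, I.mem_ball hp hρ]
    grind
  · simp only [I.mem_coBall_union hp hρ, Finset.mem_sdiff, I.mem_coBall hp hρ]
    grind

/-- The source lies in the ball and the sink in its complement: the pair is separated. -/
theorem Problem.carve_separates (hp : I.IsFeasible k p)
    (hρ0 : 0 ≤ ρ) (hρ1 : ρ < 1) (hs : I.s i ∈ S) (ht : I.t i ∈ S) :
    ¬ (I.s i ∈ I.part p T S i ρ ∧ I.t i ∈ I.part p T S i ρ) ∧
      (I.s i ∈ I.carve p T S i ρ ∨ I.t i ∈ I.carve p T S i ρ) := by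
  have hρ : ρ < 2 := by linarith
  have h1 := I.one_le_pre_sink hp i
  have h2 := I.rad_self hp i (I.s i)
  unfold Problem.part
  rcases I.carve_eq_or (p := p) (T := T) (S := S) (i := i) (ρ := ρ) with h | h <;> rw [h]
  · simp only [I.mem_ball_union hp hρ, I.mem_ball hp hρ, hs, ht, true_and]
    grind
  · simp only [I.mem_coBall_union hp hρ, I.mem_coBall hp hρ, hs, ht, true_and]
    grind

/-- When the complement is carved, the other side holds more than half of the pairs. No pair lies on
both sides, as its two distinct nodes would both be in the node-boundary. -/
theorem Problem.two_mul_card_pairsIn_part_le (hp : I.IsFeasible k p)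
    (h : I.GoodRadius 2 (1 / 2) p S i (I.s i) ρ) :
    2 * (I.pairsIn T (I.part p T S i ρ)).card ≤ T.card := by
  classical
  by_cases hc : ((I.pairsIn T (I.ball p S i (I.s i) ρ ∪ I.nodeBdry p S i (I.s i) ρ)).card : ℝ)
      ≤ (T.card : ℝ) / 2
  · rw [Problem.part, Problem.carve, if_pos hc]
    rw [le_div_iff₀ two_pos] at hc
    have : (I.pairsIn T (I.ball p S i (I.s i) ρ ∪ I.nodeBdry p S i (I.s i) ρ)).card * 2
        ≤ T.card := by exact_mod_cast hc
    omega
  · rw [Problem.part, Problem.carve, if_neg hc]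
    rw [not_le, div_lt_iff₀ two_pos] at hc
    have h1 : T.card < (I.pairsIn T (I.ball p S i (I.s i) ρ ∪ I.nodeBdry p S i (I.s i) ρ)).card * 2
        := by exact_mod_cast hc
    have hdisj : Disjoint (I.pairsIn T (I.ball p S i (I.s i) ρ ∪ I.nodeBdry p S i (I.s i) ρ))
        (I.pairsIn T (I.coBall p S i (I.s i) ρ ∪ I.nodeBdry p S i (I.s i) ρ)) := by
      rw [Finset.disjoint_left]
      intro j hj hj'
      rw [I.mem_pairsIn] at hj hj'
      have key : ∀ v, v ∈ I.ball p S i (I.s i) ρ ∪ I.nodeBdry p S i (I.s i) ρ →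
          v ∈ I.coBall p S i (I.s i) ρ ∪ I.nodeBdry p S i (I.s i) ρ →
          v ∈ I.nodeBdry p S i (I.s i) ρ := fun v hv hv' =>
        (Finset.mem_union.1 hv').resolve_left fun hv'' => (Finset.mem_sdiff.1 hv'').2 hv
      exact I.source_ne_sink hp j
        (h.eq_of_mem (key _ hj.2.1 hj'.2.1) (key _ hj.2.2 hj'.2.2))
    have h2 := Finset.card_le_card (Finset.union_subset
      (I.pairsIn_subset (T := T) (S := I.ball p S i (I.s i) ρ ∪ I.nodeBdry p S i (I.s i) ρ))
      (I.pairsIn_subset (S := I.coBall p S i (I.s i) ρ ∪ I.nodeBdry p S i (I.s i) ρ)))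
    rw [Finset.card_union_of_disjoint hdisj] at h2
    omega

theorem Problem.LoopStep.card_lt (hp : I.IsFeasible 2 p) (h : I.LoopStep p T σ σ') :
    σ'.S.card < σ.S.card := by
  obtain ⟨i, hi, ρ, hρ, rfl⟩ := h
  obtain ⟨-, hs, ht⟩ := I.mem_pairsIn.1 (I.active_subset_pairsIn hi)
  refine Finset.card_lt_card (Finset.sdiff_ssubset I.carve_subset ?_)
  rcases (I.carve_separates hp hρ.nonneg hρ.lt_one hs ht (T := T)).2 with h | h
  exacts [⟨_, h⟩, ⟨_, h⟩]

theorem Problem.loop_wellFounded (hp : I.IsFeasible 2 p) :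
    WellFounded fun σ' σ => I.LoopStep p T σ σ' :=
  Subrelation.wf (fun h => Problem.LoopStep.card_lt hp h)
    (measure fun σ : LoopState V => σ.S.card).wf

/-- Positivity of `T.card` turns the halving into a strict decrease, on which the inductions over
the recursion run. -/
theorem Problem.LoopReaches.parts_card (hp : I.IsFeasible 2 p) (h : I.LoopReaches p U T σ) :
    ∀ A ∈ σ.parts, 2 * (I.pairsIn T A).card ≤ T.card ∧ 0 < T.card := by
  induction h with
  | refl => simp
  | tail _ hstep ih =>
    obtain ⟨i, hi, ρ, hρ, rfl⟩ := hstep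
    intro A hA
    rcases Finset.mem_insert.1 hA with rfl | hA
    · exact ⟨I.two_mul_card_pairsIn_part_le hp hρ, Finset.card_pos.2 ⟨i, (I.mem_active.1 hi).1⟩⟩
    · exact ih A hA

theorem Problem.halts (hp : I.IsFeasible 2 p) (U : Finset V) (T : Finset (Fin r)) :
    I.Halts p U T := by
  induction hn : T.card using Nat.strong_induction_on generalizing U T with
  | _ n ih =>
    refine .mk U T ((I.loop_wellFounded hp).apply _)
      (fun σ _ i _ => I.exists_goodRadius hp σ.S i (I.s i)) fun σ hσ _ A hA => ?_
    have := Problem.LoopReaches.parts_card hp hσ A hA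
    exact ih _ (by omega) A _ rfl

theorem Problem.exists_returns (hp : I.IsFeasible 2 p) (U : Finset V) (T : Finset (Fin r)) :
    ∃ Z, I.Returns p U T Z := by
  induction hn : T.card using Nat.strong_induction_on generalizing U T with
  | _ n ih =>
    have hterm : ∀ σ, I.LoopReaches p U T σ → ∃ σ', I.LoopReaches p U T σ' ∧
        I.active T σ'.S = ∅ := by
      intro σ
      induction σ using (I.loop_wellFounded hp (T := T)).induction with
      | _ σ ihσ =>
        intro hσ
        rcases (I.active T σ.S).eq_empty_or_nonempty with h | ⟨i, hi⟩
        · exact ⟨σ, hσ, h⟩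
        · obtain ⟨ρ, hρ⟩ := I.exists_goodRadius hp σ.S i (I.s i)
          have hstep : I.LoopStep p T σ (I.next p T σ i ρ) := ⟨i, hi, ρ, hρ, rfl⟩
          exact ihσ _ hstep (hσ.tail hstep)
    obtain ⟨σ, hσ, hdone⟩ := hterm ⟨U, ∅, ∅⟩ .refl
    have hrec : ∀ A, ∃ Z, A ∈ σ.parts → I.Returns p A (I.pairsIn T A) Z := by
      intro A
      by_cases hA : A ∈ σ.parts
      · have := Problem.LoopReaches.parts_card hp hσ A hA
        obtain ⟨Z, hZ⟩ := ih _ (by omega) A (I.pairsIn T A) rfl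
        exact ⟨Z, fun _ => hZ⟩
      · exact ⟨∅, fun h => absurd h hA⟩
    choose W hW using hrec
    exact ⟨_, .mk U T σ W hσ hdone hW⟩

theorem Problem.LoopReaches.edges_subset (hp : I.IsFeasible 2 p) (h : I.LoopReaches p U T σ) :
    (σ.Z : Set (Sym2 V)) ⊆ I.G.edgeSet := by
  induction h with
  | refl => simp
  | tail _ hstep ih =>
    obtain ⟨i, hi, ρ, hρ, rfl⟩ := hstep
    simp only [Problem.next, Finset.coe_union]
    exact Set.union_subset ih fun e he =>
      I.mem_edgeSet_of_mem_edgesIn (I.edgeBdry_subset hp hρ.lt_two he)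

theorem Problem.Returns.edges_subset (hp : I.IsFeasible 2 p) {Z : Finset (Sym2 V)}
    (h : I.Returns p U T Z) : (Z : Set (Sym2 V)) ⊆ I.G.edgeSet := by
  induction h with
  | mk U T σ W reach done _ ih =>
    intro e he
    rcases Finset.mem_union.1 he with he | he
    · exact Problem.LoopReaches.edges_subset hp reach he
    · obtain ⟨A, hA, he⟩ := Finset.mem_biUnion.1 he
      exact ih A hA he

/-- A 2-node-connected pair survives inside `S` or inside one of the parts. -/
theorem Problem.LoopReaches.nodeConnected (hp : I.IsFeasible 2 p) (h : I.LoopReaches p U T σ)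
    {F : Set (Sym2 V)} (hF : (σ.Z : Set (Sym2 V)) ⊆ F) {s t : V}
    (hc : NodeConnected (SimpleGraph.fromEdgeSet ((I.edgesIn U : Set (Sym2 V)) \ F)) 2 s t) :
    NodeConnected (SimpleGraph.fromEdgeSet ((I.edgesIn σ.S : Set (Sym2 V)) \ F)) 2 s t ∨
      ∃ A ∈ σ.parts,
        NodeConnected (SimpleGraph.fromEdgeSet ((I.edgesIn A : Set (Sym2 V)) \ F)) 2 s t := by
  induction h with
  | refl => exact .inl hc
  | @tail σ σ' _ hstep ih =>
    obtain ⟨i, hi, ρ, hρ, rfl⟩ := hstep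
    simp only [Problem.next, Finset.coe_union, Set.union_subset_iff] at hF
    rcases ih hF.1 with h1 | ⟨A, hA, h1⟩
    swap
    · exact .inr ⟨A, Finset.mem_insert_of_mem hA, h1⟩
    have hside : ∀ W : Finset V, ∀ u v,
        (SimpleGraph.fromEdgeSet ((I.edgesIn σ.S : Set (Sym2 V)) \ F)).Adj u v → u ∈ W → v ∈ W →
        (SimpleGraph.fromEdgeSet ((I.edgesIn W : Set (Sym2 V)) \ F)).Adj u v := by
      intro W u v huv hu hv
      rw [SimpleGraph.fromEdgeSet_adj] at huv ⊢
      exact ⟨⟨I.mem_edgesIn.2 ⟨(I.mem_edgesIn.1 huv.1.1).1, hu, hv⟩, huv.1.2⟩, huv.2⟩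
    have hsplit := h1.of_separation (X := I.part p T σ.S i ρ) (Y := σ.S \ I.carve p T σ.S i ρ)
      (fun u v huv => by
        rw [SimpleGraph.fromEdgeSet_adj] at huv
        exact I.part_or_rest hp hρ.lt_two huv.1.1 fun hb => huv.1.2 (hF.2 hb))
      (fun u v hu hu' hv hv' => hρ.eq_of_mem (I.mem_nodeBdry_of_mem hu hu')
        (I.mem_nodeBdry_of_mem hv hv'))
      (hside _) (hside _)
    rcases hsplit with h2 | h2
    · exact .inr ⟨_, Finset.mem_insert_self _ _, h2⟩
    · exact .inl h2

theorem Problem.Returns.not_nodeConnected (hp : I.IsFeasible 2 p) {Z : Finset (Sym2 V)}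
    (h : I.Returns p U T Z) : ∀ i ∈ T, ¬ NodeConnected
      (SimpleGraph.fromEdgeSet ((I.edgesIn U : Set (Sym2 V)) \ (Z : Set (Sym2 V)))) 2
      (I.s i) (I.t i) := by
  induction h with
  | mk U T σ W reach done _ ih =>
    intro i hi hc
    -- Taken with the full returned set as `F`. Survival in the rest contradicts the loop exit;
    -- survival in a part contradicts the recursive call.
    rcases Problem.LoopReaches.nodeConnected hp reach (by simp) hc with h1 | ⟨A, hA, h1⟩
    · have : i ∈ I.active T σ.S :=
        I.mem_active.2 ⟨hi, h1.mono (SimpleGraph.fromEdgeSet_mono Set.sdiff_subset)⟩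
      simp [done] at this
    · have hmem := I.mem_of_nodeConnected Set.sdiff_subset h1
      refine ih A hA i (I.mem_pairsIn.2 ⟨hi, hmem⟩) (h1.mono (SimpleGraph.fromEdgeSet_mono ?_))
      refine Set.sdiff_subset_sdiff_right fun e he => ?_
      exact Finset.mem_union_right _ (Finset.mem_biUnion.2 ⟨A, hA, he⟩)

end Loop

/-! ### Cost analysis by a potential function. -/

section Cost

variable {V : Type*} [Fintype V] [DecidableEq V] {r : ℕ} {I : Problem V r} {p : LPSol V r}
  {k : ℕ} {S U : Finset V} {T : Finset (Fin r)} {i : Fin r} {z : V} {ρ : ℝ} {σ σ' : LoopState V}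

theorem Problem.edgeShare_eq_zero (hp : I.IsFeasible k p) (hρ : ρ < 2) {e : Sym2 V}
    (he : e ∈ I.edgesIn (S \ I.ball p S i z ρ)) : I.edgeShare p S i z ρ e = 0 := by
  have heS := I.edgesIn_mono Finset.sdiff_subset he
  induction e with | _ u v
  rw [I.edgeShare_mk hp hρ heS]
  simp only [I.mem_edgesIn, Finset.mem_sdiff, I.mem_ball hp hρ] at he
  unfold ballShare
  grind

theorem Problem.edgeCoShare_eq_zero (hp : I.IsFeasible k p) (hρ : ρ < 2) {e : Sym2 V}
    (he : e ∈ I.edgesIn (S \ I.coBall p S i z ρ)) : I.edgeCoShare p S i z ρ e = 0 := by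
  have heS := I.edgesIn_mono Finset.sdiff_subset he
  induction e with | _ u v
  rw [I.edgeCoShare_mk hp hρ heS]
  simp only [I.mem_edgesIn, Finset.mem_sdiff, I.mem_coBall hp hρ] at he
  unfold coShare
  grind

/-- The only edges inside the ball and its node-boundary that are not counted in full join two
boundary nodes; a single boundary node excludes them. -/
theorem Problem.le_edgeShare (hp : I.IsFeasible k p) (hρ : ρ < 2) {e : Sym2 V}
    (hcard : (I.nodeBdry p S i z ρ).card ≤ 1)
    (he : e ∈ I.edgesIn (I.ball p S i z ρ ∪ I.nodeBdry p S i z ρ)) :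
    p.x e ≤ I.edgeShare p S i z ρ e := by
  have heS := I.edgesIn_mono (Finset.union_subset I.ball_subset I.nodeBdry_subset) he
  induction e with | _ u v
  obtain ⟨hadj, hu, hv⟩ := I.mem_edgesIn.1 he
  have hnot : ¬ (u ∈ I.nodeBdry p S i z ρ ∧ v ∈ I.nodeBdry p S i z ρ) := fun h =>
    hadj.ne (Finset.card_le_one.1 hcard u h.1 v h.2)
  have h1 := I.pre_le_rad hp i z u
  have h2 := I.pre_le_rad hp i z v
  rw [I.mem_ball_union hp hρ] at hu hv
  rw [I.mem_nodeBdry hp hρ, I.mem_nodeBdry hp hρ] at hnot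
  rw [I.edgeShare_mk hp hρ heS]
  unfold ballShare
  grind

theorem Problem.le_edgeCoShare (hp : I.IsFeasible k p) (hρ : ρ < 2) {e : Sym2 V}
    (hcard : (I.nodeBdry p S i z ρ).card ≤ 1)
    (he : e ∈ I.edgesIn (I.coBall p S i z ρ ∪ I.nodeBdry p S i z ρ)) :
    p.x e ≤ I.edgeCoShare p S i z ρ e := by
  have heS := I.edgesIn_mono (Finset.union_subset I.coBall_subset I.nodeBdry_subset) he
  induction e with | _ u v
  obtain ⟨hadj, hu, hv⟩ := I.mem_edgesIn.1 he
  have hnot : ¬ (u ∈ I.nodeBdry p S i z ρ ∧ v ∈ I.nodeBdry p S i z ρ) := fun h =>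
    hadj.ne (Finset.card_le_one.1 hcard u h.1 v h.2)
  have h1 := I.pre_le_rad hp i z u
  have h2 := I.pre_le_rad hp i z v
  rw [I.mem_coBall_union hp hρ] at hu hv
  rw [I.mem_nodeBdry hp hρ, I.mem_nodeBdry hp hρ] at hnot
  rw [I.edgeCoShare_mk hp hρ heS]
  unfold coShare
  grind

/-- A volume whose edge shares are full inside `A'` and vanish inside `S'` lies between the weight
of `A'` and the weight of the edges of `S` outside `S'`. -/
theorem Problem.weight_bounds {A' S' : Finset V} {g : Sym2 V → ℝ} (hA' : A' ⊆ S)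
    (hS' : S' ⊆ S) (hg0 : ∀ e ∈ I.edgesIn S, 0 ≤ g e) (hgx : ∀ e ∈ I.edgesIn S, g e ≤ p.x e)
    (hgA : ∀ e ∈ I.edgesIn A', p.x e ≤ g e) (hgS : ∀ e ∈ I.edgesIn S', g e = 0) :
    I.weight p A' ≤ ∑ e ∈ I.edgesIn S, I.c e * g e ∧
      ∑ e ∈ I.edgesIn S, I.c e * g e + I.weight p S' ≤ I.weight p S := by
  have hc : ∀ e ∈ I.edgesIn S, 0 ≤ I.c e := fun e he =>
    I.c_nonneg e (I.mem_edgeSet_of_mem_edgesIn he)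
  constructor
  · refine (Finset.sum_le_sum fun e he => mul_le_mul_of_nonneg_left (hgA e he)
      (hc e (I.edgesIn_mono hA' he))).trans ?_
    exact Finset.sum_le_sum_of_subset_of_nonneg (I.edgesIn_mono hA')
      fun e he _ => mul_nonneg (hc e he) (hg0 e he)
  · have h1 := Finset.sum_sdiff (f := fun e => I.c e * g e) (Problem.edgesIn_mono (I := I) hS')
    have h2 := Finset.sum_sdiff (f := fun e => I.c e * p.x e) (Problem.edgesIn_mono (I := I) hS')
    have h3 : ∑ e ∈ I.edgesIn S', I.c e * g e = 0 :=
      Finset.sum_eq_zero fun e he => by rw [hgS e he, mul_zero]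
    have h4 : ∑ e ∈ I.edgesIn S \ I.edgesIn S', I.c e * g e
        ≤ ∑ e ∈ I.edgesIn S \ I.edgesIn S', I.c e * p.x e :=
      Finset.sum_le_sum fun e he => mul_le_mul_of_nonneg_left
        (hgx e (Finset.sdiff_subset he)) (hc e (Finset.sdiff_subset he))
    simp only [Problem.weight]
    linarith

/-- The volume `v` that pays for the edge-boundary: it covers the part, and it is covered by the
edges that leave `S`. -/
theorem Problem.GoodRadius.exists_volume (hp : I.IsFeasible 2 p)
    (h : I.GoodRadius 2 (1 / 2) p S i (I.s i) ρ) :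
    ∃ v, I.beta p + I.weight p (I.part p T S i ρ) ≤ v ∧
      v + I.weight p (S \ I.carve p T S i ρ) ≤ I.beta p + I.weight p S ∧
      I.cost (I.edgeBdry p S i (I.s i) ρ) ≤
        4 * Real.log (Real.log (Real.exp 1 * ((r : ℝ) + 1)))
          * (v * Real.log (Real.exp 1 * I.volSet p S / v)) := by
  have hρ := h.lt_two
  have h4 : (2 : ℝ) / (1 - 1 / 2) = 4 := by norm_num
  unfold Problem.part
  rcases I.carve_eq_or (p := p) (T := T) (S := S) (i := i) (ρ := ρ) with hc | hc <;> rw [hc]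
  · have hb := I.weight_bounds (p := p) (S' := S \ I.ball p S i (I.s i) ρ)
      (Finset.union_subset I.ball_subset I.nodeBdry_subset) Finset.sdiff_subset
      (fun e he => I.edgeShare_nonneg hp hρ he (i := i) (z := I.s i))
      (fun e he => I.edgeShare_le hp hρ he) (fun e he => I.le_edgeShare hp hρ h.card_le_one he)
      (fun e he => I.edgeShare_eq_zero hp hρ he)
    refine ⟨I.vol p S i (I.s i) ρ, ?_, ?_, ?_⟩
    · rw [I.vol_eq hp hρ]
      linarith
    · rw [I.vol_eq hp hρ]
      linarith
    · have := h.cost_le_vol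
      rw [h4] at this
      linarith
  · have hb := I.weight_bounds (p := p) (S' := S \ I.coBall p S i (I.s i) ρ)
      (Finset.union_subset I.coBall_subset I.nodeBdry_subset) Finset.sdiff_subset
      (fun e he => I.edgeCoShare_nonneg hp hρ he (i := i) (z := I.s i))
      (fun e he => I.edgeCoShare_le hp hρ he)
      (fun e he => I.le_edgeCoShare hp hρ h.card_le_one he)
      (fun e he => I.edgeCoShare_eq_zero hp hρ he)
    refine ⟨I.coVol p S i (I.s i) ρ, ?_, ?_, ?_⟩
    · rw [I.coVol_eq hp hρ]
      linarith
    · rw [I.coVol_eq hp hρ]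
      linarith
    · have := h.cost_le_coVol
      rw [h4] at this
      linarith

/-- The pairs inside the part, the pair `i` itself and the pairs that remain are distinct. -/
theorem Problem.card_pairsIn_part_add (hp : I.IsFeasible 2 p)
    (h : I.GoodRadius 2 (1 / 2) p S i (I.s i) ρ) (hi : i ∈ I.pairsIn T S) :
    (I.pairsIn T (I.part p T S i ρ)).card + 1
      + (I.pairsIn T (S \ I.carve p T S i ρ)).card ≤ (I.pairsIn T S).card := by
  obtain ⟨hiT, hs, ht⟩ := I.mem_pairsIn.1 hi
  obtain ⟨hsep1, hsep2⟩ := I.carve_separates hp h.nonneg h.lt_one hs ht (T := T)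
  have h1 : i ∉ I.pairsIn T (I.part p T S i ρ) := fun hm => hsep1 (I.mem_pairsIn.1 hm).2
  have h2 : i ∉ I.pairsIn T (S \ I.carve p T S i ρ) := fun hm => by
    have := (I.mem_pairsIn.1 hm).2
    simp only [Finset.mem_sdiff] at this
    tauto
  have hdisj : Disjoint (insert i (I.pairsIn T (I.part p T S i ρ)))
      (I.pairsIn T (S \ I.carve p T S i ρ)) := by
    rw [Finset.disjoint_insert_left]
    refine ⟨h2, Finset.disjoint_left.2 fun j hj hj' => ?_⟩
    rw [I.mem_pairsIn] at hj hj'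
    exact I.source_ne_sink hp j (h.eq_of_mem (I.mem_nodeBdry_of_mem hj.2.1 hj'.2.1)
      (I.mem_nodeBdry_of_mem hj.2.2 hj'.2.2))
  rw [← Finset.card_insert_of_notMem h1, ← Finset.card_union_of_disjoint hdisj]
  refine Finset.card_le_card (Finset.union_subset (Finset.insert_subset hi ?_) ?_)
  · intro j hj
    rw [I.mem_pairsIn] at hj ⊢
    exact ⟨hj.1, I.part_subset hj.2.1, I.part_subset hj.2.2⟩
  · intro j hj
    rw [I.mem_pairsIn] at hj ⊢
    exact ⟨hj.1, Finset.sdiff_subset hj.2.1, Finset.sdiff_subset hj.2.2⟩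

/-- The bound on the cost of a call, in terms of `β`, the weight `w` of the edges inside the node
set and the number `n` of pairs: every level of the recursion pays `w + n β`, and the logarithms
of the volume ratios telescope. -/
noncomputable def potential (β w : ℝ) (n : ℕ) : ℝ :=
  -- `n.size`, the number of binary digits, bounds the number of halvings left.
  (w + n * β) * (Real.log ((β + w) / β) + n.size)

theorem log_div_self_nonneg {β w : ℝ} (hβ : 0 ≤ β) (hw : 0 ≤ w) :
    0 ≤ Real.log ((β + w) / β) := by
  rcases hβ.eq_or_lt with rfl | hβ
  · simp
  · refine Real.log_nonneg ?_
    rw [le_div_iff₀ hβ]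
    linarith

theorem potential_nonneg {β w : ℝ} (hβ : 0 ≤ β) (hw : 0 ≤ w) (n : ℕ) : 0 ≤ potential β w n :=
  mul_nonneg (by positivity) (add_nonneg (log_div_self_nonneg hβ hw) (Nat.cast_nonneg _))

theorem size_add_one_le {m n : ℕ} (h : 2 * m ≤ n) (hn : 0 < n) : m.size + 1 ≤ n.size := by
  rw [Nat.succ_le_iff, Nat.lt_size]
  rcases Nat.eq_zero_or_pos m with rfl | hm
  · simpa using Nat.succ_le_of_lt hn
  · obtain ⟨j, hj⟩ := Nat.exists_eq_succ_of_ne_zero (Nat.size_pos.2 hm).ne'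
    rw [hj, pow_succ]
    have : 2 ^ j ≤ m := Nat.lt_size.1 (by omega)
    omega

/-- With `a = ln ((β + W) / β)` and `b = ln (v / β)`, the boundary costs at most `v (1 + a - b)` and
the part at most `(v - β + m β) (b + size n - 1)`. In the sum the terms `v b` and `v` cancel; the
remaining `b - 1`, multiplied by `m β`, is at most `a`. -/
theorem step_le_potential_of_pos {β v w' M W : ℝ} {m n : ℕ} (hβ : 0 < β) (hw' : 0 ≤ w')
    (hv : β + w' ≤ v) (hvM : v ≤ M) (hM : M ≤ β + W) (hmn : 2 * m ≤ n) (hn : 0 < n) :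
    v * Real.log (Real.exp 1 * M / v) + potential β w' m
      ≤ (v + m * β) * (Real.log ((β + W) / β) + n.size) := by
  have hv0 : 0 < v := by linarith
  have hM0 : 0 < M := by linarith
  have hW0 : 0 < β + W := by linarith
  have hsz : (m.size : ℝ) + 1 ≤ n.size := by exact_mod_cast size_add_one_le hmn hn
  have hms : (0 : ℝ) ≤ m.size := Nat.cast_nonneg _
  have hm0 : (0 : ℝ) ≤ m := Nat.cast_nonneg _
  set a := Real.log ((β + W) / β) with ha
  set b := Real.log (v / β) with hb
  have hba : b ≤ a := Real.log_le_log (by positivity) (by gcongr; linarith)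
  have hb0 : 0 ≤ b := Real.log_nonneg (by rw [le_div_iff₀ hβ]; linarith)
  have h1 : Real.log (Real.exp 1 * M / v) ≤ 1 + (a - b) := by
    rw [Real.log_div (by positivity) hv0.ne', Real.log_mul (Real.exp_ne_zero _) hM0.ne',
      Real.log_exp, ha, hb, Real.log_div hW0.ne' hβ.ne', Real.log_div hv0.ne' hβ.ne']
    linarith [Real.log_le_log hM0 hM]
  have h2 : potential β w' m ≤ (v - β + m * β) * (b + (n.size - 1)) := by
    refine mul_le_mul (by linarith) (add_le_add (Real.log_le_log (by positivity) ?_) (by linarith))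
      (add_nonneg (log_div_self_nonneg hβ.le hw') hms) ?_
    · gcongr
    · have := mul_nonneg hm0 hβ.le
      linarith
  have h3 := mul_le_mul_of_nonneg_left h1 hv0.le
  have h4 : 0 ≤ β * (b + (n.size - 1)) := mul_nonneg hβ.le (by linarith)
  have h5 : 0 ≤ (m * β) * (a - b + 1) := mul_nonneg (by positivity) (by linarith)
  nlinarith

theorem step_le_potential {β v w' M W : ℝ} {m n : ℕ} (hβ : 0 ≤ β) (hM0 : β = 0 → M ≤ 0)
    (hw' : 0 ≤ w') (hv : β + w' ≤ v) (hvM : v ≤ M) (hM : M ≤ β + W) (hmn : 2 * m ≤ n)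
    (hn : 0 < n) :
    v * Real.log (Real.exp 1 * M / v) + potential β w' m
      ≤ (v + m * β) * (Real.log ((β + W) / β) + n.size) := by
  rcases hβ.eq_or_lt with rfl | hβ
  -- Without volume both sides are `0`.
  · have := hM0 rfl
    obtain rfl : v = 0 := by linarith
    obtain rfl : w' = 0 := by linarith
    simp [potential]
  · exact step_le_potential_of_pos hβ hw' hv hvM hM hmn hn

/-- Costs are nonnegative only on edges of `G`; it suffices that one of the sets consists of such
edges, since the overlap lies in it. -/
theorem Problem.cost_union_le {F F' : Finset (Sym2 V)}
    (h : (F : Set (Sym2 V)) ⊆ I.G.edgeSet) : I.cost (F ∪ F') ≤ I.cost F + I.cost F' := by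
  have h1 := Finset.sum_union_inter (s₁ := F) (s₂ := F') (f := I.c)
  have h2 : 0 ≤ ∑ e ∈ F ∩ F', I.c e :=
    Finset.sum_nonneg fun e he => I.c_nonneg e (h (Finset.inter_subset_left he))
  simp only [Problem.cost]
  linarith

theorem Problem.cost_biUnion_le (P : Finset (Finset V)) (W : Finset V → Finset (Sym2 V))
    (h : ∀ A ∈ P, (W A : Set (Sym2 V)) ⊆ I.G.edgeSet) :
    I.cost (P.biUnion W) ≤ ∑ A ∈ P, I.cost (W A) := by
  induction P using Finset.induction_on with
  | empty => simp [Problem.cost]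
  | insert A P hA ih =>
    rw [Finset.biUnion_insert, Finset.sum_insert hA]
    exact (I.cost_union_le (h A (Finset.mem_insert_self _ _))).trans
      (add_le_add le_rfl (ih fun B hB => h B (Finset.mem_insert_of_mem hB)))

theorem log_log_nonneg (r : ℕ) : 0 ≤ Real.log (Real.log (Real.exp 1 * ((r : ℝ) + 1))) := by
  have hr : (0 : ℝ) ≤ r := Nat.cast_nonneg r
  refine Real.log_nonneg ?_
  rw [Real.log_mul (Real.exp_ne_zero _) (by positivity), Real.log_exp]
  linarith [Real.log_nonneg (by linarith : (1 : ℝ) ≤ r + 1)]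

/-- The loop invariant: edges bought so far and potentials of the parts are paid by the edges and
pairs that have left `S`. -/
theorem Problem.LoopReaches.cost_le (hp : I.IsFeasible 2 p) (h : I.LoopReaches p U T σ) :
    σ.S ⊆ U ∧ I.cost σ.Z + ∑ A ∈ σ.parts, 4 * Real.log (Real.log (Real.exp 1 * ((r : ℝ) + 1)))
        * potential (I.beta p) (I.weight p A) (I.pairsIn T A).card
      ≤ 4 * Real.log (Real.log (Real.exp 1 * ((r : ℝ) + 1)))
        * ((I.weight p U - I.weight p σ.S + (T.card - (I.pairsIn T σ.S).card) * I.beta p)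
          * (Real.log ((I.beta p + I.weight p U) / I.beta p) + T.card.size)) := by
  have hL := log_log_nonneg r
  have hβ := I.beta_nonneg hp
  set L := Real.log (Real.log (Real.exp 1 * ((r : ℝ) + 1))) with hLdef
  -- `K` depends on the call only, not on the current `S`, so the charges of all iterations share
  -- this factor and add up.
  set K := Real.log ((I.beta p + I.weight p U) / I.beta p) + (T.card.size : ℝ) with hK
  have hK0 : 0 ≤ K := add_nonneg (log_div_self_nonneg hβ (I.weight_nonneg hp U)) (by simp)
  induction h with
  | refl =>
    refine ⟨subset_rfl, ?_⟩
    have : ((I.pairsIn T U).card : ℝ) ≤ T.card := by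
      exact_mod_cast Finset.card_le_card I.pairsIn_subset
    simp only [Problem.cost, Finset.sum_empty, add_zero, sub_self, zero_add]
    exact mul_nonneg (by positivity) (mul_nonneg (mul_nonneg (by linarith) hβ) hK0)
  | @tail σ σ' hreach hstep ih =>
    obtain ⟨i, hi, ρ, hρ, rfl⟩ := hstep
    obtain ⟨hSU, ih⟩ := ih
    refine ⟨Finset.sdiff_subset.trans hSU, ?_⟩
    have hiS := I.active_subset_pairsIn hi
    obtain ⟨v, hv1, hv2, hv3⟩ := hρ.exists_volume hp (T := T)
    have hcard : ((I.pairsIn T (I.part p T σ.S i ρ)).card : ℝ) + 1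
        + (I.pairsIn T (σ.S \ I.carve p T σ.S i ρ)).card ≤ (I.pairsIn T σ.S).card := by
      exact_mod_cast I.card_pairsIn_part_add hp hρ hiS
    have hpw := I.weight_nonneg hp (I.part p T σ.S i ρ)
    have hvM : v ≤ I.volSet p σ.S := by
      rw [I.volSet_eq]
      linarith [I.weight_nonneg hp (σ.S \ I.carve p T σ.S i ρ)]
    have hMU : I.volSet p σ.S ≤ I.beta p + I.weight p U := by
      rw [I.volSet_eq]
      linarith [I.weight_mono hp hSU]
    have hM0 : I.beta p = 0 → I.volSet p σ.S ≤ 0 := fun h0 => by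
      simpa [h0] using I.volSet_le hp i.pos σ.S
    have hpot := step_le_potential hβ hM0 hpw hv1 hvM hMU
      (I.two_mul_card_pairsIn_part_le hp hρ)
      (Finset.card_pos.2 ⟨i, (I.mem_pairsIn.1 hiS).1⟩)
    rw [← hK] at hpot
    have hZ : I.cost (I.next p T σ i ρ).Z
        ≤ I.cost σ.Z + I.cost (I.edgeBdry p σ.S i (I.s i) ρ) :=
      I.cost_union_le (Problem.LoopReaches.edges_subset hp hreach)
    have hparts : ∑ A ∈ (I.next p T σ i ρ).parts,
          4 * L * potential (I.beta p) (I.weight p A) (I.pairsIn T A).card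
        ≤ 4 * L * potential (I.beta p) (I.weight p (I.part p T σ.S i ρ))
            (I.pairsIn T (I.part p T σ.S i ρ)).card
          + ∑ A ∈ σ.parts, 4 * L * potential (I.beta p) (I.weight p A) (I.pairsIn T A).card := by
      change ∑ A ∈ insert (I.part p T σ.S i ρ) σ.parts, _ ≤ _
      -- A part that occurs again is recursed on only once; its potential is nonnegative, so the
      -- bound still holds.
      by_cases hmem : I.part p T σ.S i ρ ∈ σ.parts
      · rw [Finset.insert_eq_of_mem hmem]
        have := potential_nonneg hβ hpw (I.pairsIn T (I.part p T σ.S i ρ)).card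
        exact le_add_of_nonneg_left (by positivity)
      · rw [Finset.sum_insert hmem]
    -- The `β` contained in `v` is paid by the pair `i`, which lies neither in the part nor in the
    -- rest.
    have hstep : (v + (I.pairsIn T (I.part p T σ.S i ρ)).card * I.beta p)
        ≤ (I.weight p σ.S - I.weight p (σ.S \ I.carve p T σ.S i ρ))
          + ((I.pairsIn T σ.S).card - (I.pairsIn T (σ.S \ I.carve p T σ.S i ρ)).card)
            * I.beta p := by
      have := mul_le_mul_of_nonneg_right hcard hβ
      nlinarith
    have h1 := mul_le_mul_of_nonneg_left
      (hpot.trans (mul_le_mul_of_nonneg_right hstep hK0)) (by positivity : 0 ≤ 4 * L)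
    simp only [Problem.next] at hZ hparts ⊢
    nlinarith

theorem Problem.Returns.cost_le (hp : I.IsFeasible 2 p) {Z : Finset (Sym2 V)}
    (h : I.Returns p U T Z) :
    I.cost Z ≤ 4 * Real.log (Real.log (Real.exp 1 * ((r : ℝ) + 1)))
      * potential (I.beta p) (I.weight p U) T.card := by
  induction h with
  | mk U T σ W reach done hrec ih =>
    have hL := log_log_nonneg r
    have hβ := I.beta_nonneg hp
    have h1 := (Problem.LoopReaches.cost_le hp reach).2
    have h2 := I.cost_union_le (F' := σ.parts.biUnion W)
      (Problem.LoopReaches.edges_subset hp reach)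
    have h3 := I.cost_biUnion_le σ.parts W fun A hA => (hrec A hA).edges_subset hp
    have h4 := Finset.sum_le_sum ih
    refine (h2.trans (add_le_add le_rfl (h3.trans h4))).trans (h1.trans ?_)
    refine mul_le_mul_of_nonneg_left (mul_le_mul_of_nonneg_right ?_ ?_) (by positivity)
    · have h5 := I.weight_nonneg hp σ.S
      have h6 : (0 : ℝ) ≤ (I.pairsIn T σ.S).card * I.beta p := by positivity
      linarith
    · exact add_nonneg (log_div_self_nonneg hβ (I.weight_nonneg hp U)) (by simp)

/-- The approximation factor. -/
noncomputable def factor (r : ℕ) : ℝ :=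
  8 * Real.log (Real.log (Real.exp 1 * ((r : ℝ) + 1))) * (Real.log ((r : ℝ) + 1) + r.size)

/-- Since `r β = OPT`, the first factor is `2 OPT` and the volume ratio is `r + 1`; in the
degenerate cases both sides are `0`. -/
theorem Problem.potential_univ :
    potential (I.beta p) (I.weight p Finset.univ) r
      = 2 * (Real.log ((r : ℝ) + 1) + r.size) * I.value p := by
  rw [← I.value_eq_weight, potential]
  rcases Nat.eq_zero_or_pos r with hr | hr
  · have hβ : I.beta p = 0 := by simp [Problem.beta, hr]
    simp [hβ, hr]
  have hr' : (r : ℝ) ≠ 0 := by exact_mod_cast hr.ne'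
  have h : (r : ℝ) * I.beta p = I.value p := by rw [Problem.beta, mul_div_cancel₀ _ hr']
  rcases eq_or_ne (I.beta p) 0 with h0 | h0
  · rw [h0, mul_zero] at h
    rw [← h, h0]
    simp
  · have h2 : (I.beta p + I.value p) / I.beta p = r + 1 := by
      rw [← h]
      field_simp
      ring
    rw [h2, h]
    ring

theorem Problem.Returns.cost_le_factor (hp : I.IsFeasible 2 p) {Z : Finset (Sym2 V)}
    (h : I.Returns p Finset.univ Finset.univ Z) : I.cost Z ≤ factor r * I.value p := by
  have h1 := h.cost_le hp
  rw [Finset.card_univ, Fintype.card_fin, I.potential_univ (p := p)] at h1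
  refine h1.trans_eq ?_
  rw [factor]
  ring

/-- From `2 ^ j ≤ r` with `size r = j + 1`: as `ln 2 > 1/2`, both `j` and `1` are at most `2 ln r`.
-/
theorem size_le_log (r : ℕ) (hr : 2 ≤ r) : (r.size : ℝ) ≤ 4 * Real.log r := by
  obtain ⟨j, hj⟩ := Nat.exists_eq_succ_of_ne_zero (Nat.size_pos.2 (by omega : 0 < r)).ne'
  have h1 : 2 ^ j ≤ r := Nat.lt_size.1 (by omega)
  have h2 : (j : ℝ) * Real.log 2 ≤ Real.log r := by
    rw [← Real.log_pow]
    exact Real.log_le_log (by positivity) (by exact_mod_cast h1)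
  have h3 : Real.log 2 ≤ Real.log r := Real.log_le_log two_pos (by exact_mod_cast hr)
  have h4 := Real.log_two_gt_d9
  have hj0 : (0 : ℝ) ≤ j := Nat.cast_nonneg j
  rw [hj]
  push_cast
  nlinarith

theorem factor_isBigO :
    factor =O[atTop] fun r : ℕ => Real.log (r : ℝ) * Real.log (Real.log (r : ℝ)) := by
  -- `96 = 8 * 2 * (2 + 4)`, the constants of `factor`, `h2`, `h1` and `h3`.
  refine IsBigO.of_bound 96 ?_
  have hlog : Tendsto (fun r : ℕ => Real.log (r : ℝ)) atTop atTop :=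
    Real.tendsto_log_atTop.comp tendsto_natCast_atTop_atTop
  filter_upwards [hlog.eventually_ge_atTop 3, eventually_ge_atTop 2] with r hl hr
  have hr' : (2 : ℝ) ≤ r := by exact_mod_cast hr
  have h1 : Real.log ((r : ℝ) + 1) ≤ 2 * Real.log r := by
    rw [two_mul, ← Real.log_mul (by linarith) (by linarith)]
    exact Real.log_le_log (by linarith) (by nlinarith)
  have h2 : Real.log (Real.log (Real.exp 1 * ((r : ℝ) + 1))) ≤ 2 * Real.log (Real.log r) := by
    rw [two_mul, ← Real.log_mul (by linarith) (by linarith),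
      Real.log_mul (Real.exp_ne_zero _) (by positivity), Real.log_exp]
    have := Real.log_nonneg (by linarith : (1 : ℝ) ≤ r + 1)
    exact Real.log_le_log (by linarith) (by nlinarith)
  have h3 := size_le_log r hr
  have h4 := log_log_nonneg r
  have h5 := Real.log_nonneg (by linarith : (1 : ℝ) ≤ r + 1)
  have h6 : 0 ≤ Real.log (Real.log r) := Real.log_nonneg (by linarith)
  rw [Real.norm_of_nonneg (mul_nonneg (by linarith) (by linarith)), factor, Real.norm_of_nonneg (by
    have : (0 : ℝ) ≤ r.size := Nat.cast_nonneg _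
    positivity)]
  calc _ ≤ 8 * (2 * Real.log (Real.log r)) * (2 * Real.log r + 4 * Real.log r) := by gcongr
    _ = _ := by ring

end Cost

end EDNMC

theorem theorem5p6 :
    ∃ f : ℕ → ℝ,
      f =O[atTop] (fun r : ℕ => Real.log (r : ℝ) * Real.log (Real.log (r : ℝ))) ∧
      ∀ (V : Type*) [Fintype V] [DecidableEq V] (r : ℕ) (I : EDNMC.Problem V r)
        (p : EDNMC.LPSol V r), I.IsOptimal 2 p →
        I.Halts p Finset.univ Finset.univ ∧
        (∃ Z, I.Returns p Finset.univ Finset.univ Z) ∧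
        ∀ Z, I.Returns p Finset.univ Finset.univ Z →
          (Z : Set (Sym2 V)) ⊆ I.G.edgeSet ∧
          (∀ i, ¬ EDNMC.NodeConnected (I.G.deleteEdges (Z : Set (Sym2 V))) 2 (I.s i) (I.t i)) ∧
          I.cost Z ≤ f r * I.value p := by
  refine ⟨EDNMC.factor, EDNMC.factor_isBigO, fun V _ _ r I p hopt => ?_⟩
  have hp := hopt.1
  refine ⟨I.halts hp _ _, I.exists_returns hp _ _, fun Z hZ =>
    ⟨hZ.edges_subset hp, fun i hc => ?_, hZ.cost_le_factor hp⟩⟩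
  refine hZ.not_nodeConnected hp i (Finset.mem_univ i) (hc.mono fun u v huv => ?_)
  rw [SimpleGraph.deleteEdges_adj] at huv
  rw [SimpleGraph.fromEdgeSet_adj]
  exact ⟨⟨I.mem_edgesIn.2 ⟨huv.1, Finset.mem_univ u, Finset.mem_univ v⟩, huv.2⟩, huv.1.ne⟩
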